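/- Let $K\ge 1$ be an integer (the number of colours). For $1\le i\le K$ let $(b_{ik})_{k\ge 0}$ be non-negative reals with $b_{i0}>0$, $b_{i1}>0$, such that $B_i(\theta)=\sum_{k\ge 0} b_{ik}\theta^k/k!$ has radius of convergence $R_i\in(0,\infty]$. For $0<\theta<R_i$ let $\xi_i(\theta)$ be a random variable with $$\mathbb P\{\xi_i(\theta)=k\}=\frac{b_{ik}\theta^k}{k!\,B_i(\theta)},\qquad k=0,1,2,\dots,$$ and let $m_i(\theta)=\mathbb E\,\xi_i(\theta)$; $m_i$ is strictly increasing on $(0,R_i)$, and $m_i^{-1}$ denotes its inverse. Let $0<\alpha_i'<\alpha_i''$ be such that $\alpha_i''=m_i(\theta_i'')$ for some $\theta_i''\in(0,R_i)$, that is, $m_i^{-1}(\alpha_i'')<R_i$. For each $t\in\mathbb N$ let $N_t$ (boxes) and $n_{1t},\dots,n_{Kt}$ (balls of each colour) be positive integers with $N_t<N_{t+1}$ and $$\alpha_i'<\alpha_{it}:=\frac{n_{it}}{N_t}<\alpha_i''\qquad\text{for all } t \text{ and } 1\le i\le K,$$ and let $\boldsymbol\eta_{1}^{(t)},\dots,\boldsymbol\eta_{N_t}^{(t)}$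 be $\mathbb N_0^K$-valued random vectors such that $$\mathbb P\{\boldsymbol\eta^{(t)}_{j}=(k_{1j},\dots,k_{Kj}),\ 1\le j\le N_t\}=\prod_{i=1}^K\mathbb P\{\xi_{i1}=k_{i1},\dots,\xi_{iN_t}=k_{iN_t}\mid \xi_{i1}+\dots+\xi_{iN_t}=n_{it}\}$$ for all non-negative integers $k_{ij}$ with $k_{i1}+\dots+k_{iN_t}=n_{it}$ for every $i$. Here $\xi_{i1},\dots,\xi_{iN_t}$ are independent copies of $\xi_i(\vartheta_{it})$ for some $\vartheta_{it}\in(0,R_i)$ (the right-hand side does not depend on the choice of $\vartheta_{it}$), and the conditioning events are assumed to have positive probability. All the random vectors $\boldsymbol\eta^{(t)}_j$ are defined on one probability space; nothing is assumed about their joint distribution for different $t$. Fix $\mathbf s=(s_1,\dots,s_K)\in\mathbb N_0^K$ with $b_{is_i}>0$ for $1\le i\le K$. With $\theta_{it}=m_i^{-1}(\alpha_{it})$ put $$\mu_{\mathbf s t}=\#\{1\le j\le N_t:\ \boldsymbol\eta_j^{(t)}=\mathbf s\},\qquad p_{\mathbf s t}=\prod_{i=1}^K\frac{b_{is_i}\theta_{it}^{s_i}}{s_i!\,B_i(\theta_{it})},\qquad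 \sigma_{\mathbf s t}=\sqrt{p_{\mathbf s t}(1-p_{\mathbf s t})}.$$ Then $$\limsup_{t\to\infty}\frac{|\mu_{\mathbf s t}-\mathbb E\mu_{\mathbf s t}|}{\sqrt{N_t\ln N_t}\;\sigma_{\mathbf s t}}\le 4\sqrt{1+\frac K2}\qquad\text{almost surely.}$$ -/

import Mathlib

namespace MultiColourAllocation

open MeasureTheory ProbabilityTheory

noncomputable section

/-- The radius of convergence `R ∈ [0, ∞]` of the power series `∑ b_k θ^k / k!`. -/
def radius (b : ℕ → ℝ) : ENNReal :=
  (FormalMultilinearSeries.ofScalars ℝ (fun k => b k / (Nat.factorial k : ℝ))).radius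

/-- The set of admissible parameters `0 < θ < R`. -/
def params (b : ℕ → ℝ) : Set ℝ := {θ | 0 < θ ∧ ENNReal.ofReal θ < radius b}

/-- `B(θ) = ∑ b_k θ^k / k!`. -/
def B (b : ℕ → ℝ) (θ : ℝ) : ℝ := ∑' k : ℕ, b k * θ ^ k / (Nat.factorial k : ℝ)

/-- The weight `P(ξ(θ) = k) = b_k θ^k / (k! B(θ))`. -/
def weight (b : ℕ → ℝ) (θ : ℝ) (k : ℕ) : ℝ := b k * θ ^ k / ((Nat.factorial k : ℝ) * B b θ)

/-- The law on `ℕ` of the power series distributed random variable `ξ(θ)`. -/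
def law (b : ℕ → ℝ) (θ : ℝ) : Measure ℕ :=
  Measure.sum (fun k => ENNReal.ofReal (weight b θ k) • Measure.dirac k)

/-- The expectation `m(θ) = E ξ(θ)`. -/
def mean (b : ℕ → ℝ) (θ : ℝ) : ℝ := ∑' k : ℕ, (k : ℝ) * weight b θ k

/-- The inverse function of `m` on `0 < θ < R` (where `m` is strictly increasing as soon as
`b ≥ 0` and `b_0, b_1 > 0`); it is meaningful at the values that `m` takes there. -/
def meanInv (b : ℕ → ℝ) (α : ℝ) : ℝ := Function.invFunOn (mean b) (params b) α

/-- The random vectors `η_j = (η_{1j}, …, η_{Kj})`, `j` running over `N` boxes, obey the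
multi-colour generalized allocation scheme placing `n_i` balls of colour `i`, `1 ≤ i ≤ K`, into
the boxes, where `ν i j` is the law of `ξ_{ij}`; the joint law of the independent random
variables `ξ_{i1}, …, ξ_{iN}` is the product measure `Measure.pi (ν i)`. -/
structure IsScheme {Ω : Type*} [MeasurableSpace Ω] (P : Measure Ω) {K N : ℕ}
    (n : Fin K → ℕ) (ν : Fin K → Fin N → Measure ℕ) (η : Fin N → Ω → (Fin K → ℕ)) : Prop where
  /-- The `η_j` are random vectors. -/
  measurable : ∀ j, Measurable (η j)
  /-- The conditioning events have positive probability. -/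
  pos : ∀ i, Measure.pi (ν i) {x | ∑ j, x j = n i} ≠ 0
  /-- `P(η_1 = k_1, …, η_N = k_N) = ∏ i, P(ξ_{i1} = k_{i1}, …, ξ_{iN} = k_{iN} | ∑ j, ξ_{ij} = n_i)`
  whenever `k_{i1} + … + k_{iN} = n_i` for all `i`. -/
  prob_eq : ∀ k : Fin N → Fin K → ℕ, (∀ i, ∑ j, k j i = n i) →
    P {ω | ∀ j, η j ω = k j} =
      ∏ i, cond (Measure.pi (ν i)) {x | ∑ j, x j = n i} {x | ∀ j, x j = k j i}

/-- The number `μ_s` of boxes containing exactly `s_i` balls of colour `i` for every `i`. -/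
def boxCount {Ω : Type*} {K N : ℕ} (η : Fin N → Ω → (Fin K → ℕ)) (s : Fin K → ℕ) (ω : Ω) : ℝ :=
  ∑ j, if η j ω = s then 1 else 0

/-- `p_s = ∏ i, b_{i s_i} θ_i^{s_i} / (s_i! B_i(θ_i))`. -/
def boxProb {K : ℕ} (b : Fin K → ℕ → ℝ) (θ : Fin K → ℝ) (s : Fin K → ℕ) : ℝ :=
  ∏ i, weight (b i) (θ i) (s i)

/-- `σ_s = √(p_s (1 - p_s))`. -/
def boxSigma {K : ℕ} (b : Fin K → ℕ → ℝ) (θ : Fin K → ℝ) (s : Fin K → ℕ) : ℝ :=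
  Real.sqrt (boxProb b θ s * (1 - boxProb b θ s))

end

end MultiColourAllocation

namespace MultiColourAllocation

open MeasureTheory ProbabilityTheory Filter Topology

/-! ### Power series distributions: moments, the mean and its inverse. -/

section PowerSeries

variable {b : ℕ → ℝ} {θ θ' θ'' : ℝ}

/-! Conditionally on the totals, the law of independent `ξ(θ)` does not depend on `θ`, so each
colour may be given the parameter whose mean is `α = n / N`. The condition then sits at the mean of
the sum, and a local limit theorem bounds its probability below by `c / √N`. Hence every event of
the allocation scheme has at most `C * N ^ (K / 2)` times its probability for independent boxes
(`IsScheme.measure_le`).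

For independent boxes the count is binomial with parameters `N` and `p`, and a Bernstein type bound
gives `2 * exp (-3 x² / (8 v N))` for deviations `x ≤ v N`, where `v = p (1 - p)`. At `x = 2 √(1 + K
/ 2) √(N log N) σ` this is `2 * N ^ (-(3 / 2) (1 + K / 2))`, which beats the factor `N ^ (K / 2)`
and leaves `O(N ^ (-3 / 2))`. Since `N t ≥ t`, the tails are summable in `t`, and Borel–Cantelli
applies whatever the dependence between different `t`. The same tail shows that the expectation
differs from `N p` by at most `x + O(1)`; replacing `N p` by the expectation therefore doubles the
constant 2 to 4.

All constants must be uniform in `t`. The bounds on `α` confine `θ` to a compact subinterval of `(0,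
R)`, where third moments are bounded and the masses at `0`, `1` and `s` are bounded below
(`exists_uniform_bounds`). The masses at `0` and `1` control the characteristic function away from
the origin, which makes the local limit theorem (`exists_le_measureReal_sum_eq`) uniform; they also
keep `p` away from `1`. -/

lemma summable_moment (hb : ∀ k, 0 ≤ b k) (hθ : θ ∈ params b) (r : ℕ) :
    Summable fun k : ℕ => (k : ℝ) ^ r * (b k * θ ^ k / (Nat.factorial k : ℝ)) := by
  obtain ⟨h0, h1⟩ := hθ
  have h1' : ((θ.toNNReal : NNReal) : ENNReal) <
      (FormalMultilinearSeries.ofScalars ℝ (fun k => b k / (Nat.factorial k : ℝ))).radius := h1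
  -- Strictly inside the disc of convergence the terms are at most `C * a ^ k` with `a < 1`, which
  -- absorbs the polynomial factor.
  obtain ⟨a, ha, C, hC, h⟩ :=
    FormalMultilinearSeries.norm_mul_pow_le_mul_pow_of_lt_radius _ h1'
  have hs : Summable fun k : ℕ => C * ((k : ℝ) ^ r * a ^ k) := by
    refine Summable.mul_left _ (summable_pow_mul_geometric_of_norm_lt_one r ?_)
    rw [Real.norm_of_nonneg ha.1.le]
    exact ha.2
  refine Summable.of_nonneg_of_le (fun k => ?_) (fun k => ?_) hs
  · have := hb k
    positivity
  · have hk := h k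
    rw [FormalMultilinearSeries.ofScalars_norm, Real.norm_of_nonneg
      (div_nonneg (hb k) (by positivity)), Real.coe_toNNReal _ h0.le] at hk
    calc (k : ℝ) ^ r * (b k * θ ^ k / (Nat.factorial k : ℝ))
        = (k : ℝ) ^ r * (b k / (Nat.factorial k : ℝ) * θ ^ k) := by ring
      _ ≤ (k : ℝ) ^ r * (C * a ^ k) := by gcongr
      _ = _ := by ring

lemma summable_terms (hb : ∀ k, 0 ≤ b k) (hθ : θ ∈ params b) :
    Summable fun k : ℕ => b k * θ ^ k / (Nat.factorial k : ℝ) := by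
  simpa using summable_moment hb hθ 0

lemma mem_params_of_le (hθ'' : θ'' ∈ params b) (h0 : 0 < θ) (h : θ ≤ θ'') : θ ∈ params b :=
  ⟨h0, (ENNReal.ofReal_le_ofReal h).trans_lt hθ''.2⟩

lemma le_B (hb : ∀ k, 0 ≤ b k) (hθ : θ ∈ params b) : b 0 ≤ B b θ := by
  have h := (summable_terms hb hθ).le_tsum 0 (fun k _ => by
    have := hb k
    have := hθ.1
    positivity)
  simpa [B] using h

lemma B_pos (hb : ∀ k, 0 ≤ b k) (hb0 : 0 < b 0) (hθ : θ ∈ params b) : 0 < B b θ :=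
  hb0.trans_le (le_B hb hθ)

lemma B_mono (hb : ∀ k, 0 ≤ b k) (hθ : θ ∈ params b) (hθ'' : θ'' ∈ params b) (h : θ ≤ θ'') :
    B b θ ≤ B b θ'' := by
  refine Summable.tsum_le_tsum (fun k => ?_) (summable_terms hb hθ) (summable_terms hb hθ'')
  have := hb k
  have := hθ.1
  gcongr

lemma weight_eq (b : ℕ → ℝ) (θ : ℝ) (k : ℕ) :
    weight b θ k = b k * θ ^ k / (Nat.factorial k : ℝ) / B b θ := by
  rw [weight, div_div]

lemma weight_nonneg (hb : ∀ k, 0 ≤ b k) (hb0 : 0 < b 0) (hθ : θ ∈ params b) (k : ℕ) :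
    0 ≤ weight b θ k := by
  have := hb k
  have := hθ.1
  have := B_pos hb hb0 hθ
  rw [weight]
  positivity

lemma summable_pow_mul_weight (hb : ∀ k, 0 ≤ b k) (hθ : θ ∈ params b) (r : ℕ) :
    Summable fun k : ℕ => (k : ℝ) ^ r * weight b θ k := by
  simpa only [weight_eq, mul_div_assoc] using (summable_moment hb hθ r).div_const (B b θ)

lemma summable_weight (hb : ∀ k, 0 ≤ b k) (hθ : θ ∈ params b) : Summable (weight b θ) := by
  simpa using summable_pow_mul_weight hb hθ 0

lemma tsum_weight (hb : ∀ k, 0 ≤ b k) (hb0 : 0 < b 0) (hθ : θ ∈ params b) :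
    ∑' k, weight b θ k = 1 := by
  simp only [weight_eq]
  rw [tsum_div_const]
  exact div_self (B_pos hb hb0 hθ).ne'

lemma law_singleton (b : ℕ → ℝ) (θ : ℝ) (k : ℕ) :
    law b θ {k} = ENNReal.ofReal (weight b θ k) := by
  rw [law, Measure.sum_apply _ (measurableSet_singleton k), tsum_eq_single k]
  · simp
  · intro j hj
    simp [hj]

lemma isProbabilityMeasure_law (hb : ∀ k, 0 ≤ b k) (hb0 : 0 < b 0) (hθ : θ ∈ params b) :
    IsProbabilityMeasure (law b θ) := by
  constructor
  rw [law, Measure.sum_apply _ MeasurableSet.univ]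
  simp only [Measure.smul_apply, measure_univ, smul_eq_mul, mul_one]
  rw [← ENNReal.ofReal_tsum_of_nonneg (weight_nonneg hb hb0 hθ) (summable_weight hb hθ),
    tsum_weight hb hb0 hθ, ENNReal.ofReal_one]

lemma integrable_law (hb : ∀ k, 0 ≤ b k) (hb0 : 0 < b 0) (hθ : θ ∈ params b) {f : ℕ → ℝ}
    (hf : Summable fun k => weight b θ k * |f k|) : Integrable f (law b θ) := by
  refine integrable_sum_dirac (fun _ => ENNReal.ofReal_ne_top) ?_
  simpa only [ENNReal.toReal_ofReal (weight_nonneg hb hb0 hθ _), Real.norm_eq_abs] using hf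

lemma integral_law (hb : ∀ k, 0 ≤ b k) (hb0 : 0 < b 0) (hθ : θ ∈ params b) (f : ℕ → ℝ) :
    ∫ k, f k ∂(law b θ) = ∑' k, weight b θ k * f k := by
  rw [law, integral_sum_dirac (fun _ => ENNReal.ofReal_ne_top)]
  simp only [ENNReal.toReal_ofReal (weight_nonneg hb hb0 hθ _), smul_eq_mul]

lemma summable_mul_weight (hb : ∀ k, 0 ≤ b k) (hθ : θ ∈ params b) :
    Summable fun k : ℕ => (k : ℝ) * weight b θ k := by
  simpa using summable_pow_mul_weight hb hθ 1

lemma tsum_sub_mul_weight (hb : ∀ k, 0 ≤ b k) (hb0 : 0 < b 0) (hθ : θ ∈ params b) (m : ℝ) :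
    ∑' k : ℕ, ((k : ℝ) - m) * weight b θ k = mean b θ - m := by
  simp only [sub_mul]
  rw [(summable_mul_weight hb hθ).tsum_sub ((summable_weight hb hθ).mul_left m),
    tsum_mul_left, tsum_weight hb hb0 hθ, mul_one, mean]

lemma summable_sub_mul_weight (hb : ∀ k, 0 ≤ b k) (hθ : θ ∈ params b) (m : ℝ) :
    Summable fun k : ℕ => ((k : ℝ) - m) * weight b θ k := by
  simp only [sub_mul]
  exact (summable_mul_weight hb hθ).sub ((summable_weight hb hθ).mul_left m)

/-- The mean is monotone: the increments of `k` and `ρ ^ k` are positively correlated. -/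
lemma mean_mono (hb : ∀ k, 0 ≤ b k) (hb0 : 0 < b 0) (hθ : θ ∈ params b) (hθ'' : θ'' ∈ params b)
    (h : θ ≤ θ'') : mean b θ ≤ mean b θ'' := by
  set m := mean b θ with hm
  set ρ := θ'' / θ with hρ
  have hθ0 := hθ.1
  have hρ1 : 1 ≤ ρ := (one_le_div hθ0).2 h
  have hB := B_pos hb hb0 hθ
  have hB'' := B_pos hb hb0 hθ''
  have hw : ∀ k, weight b θ'' k = B b θ / B b θ'' * (weight b θ k * ρ ^ k) := by
    intro k
    rw [weight_eq, weight_eq, hρ, div_pow]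
    field_simp
  -- The law at `θ''` is the law at `θ` tilted by `ρ ^ k`, and `(k - m) * (ρ ^ k - ρ ^ m) ≥ 0`.
  -- After summation the left side vanishes because `m` is the mean at `θ`.
  have key : ∀ k : ℕ, B b θ / B b θ'' * ρ ^ m * (((k : ℝ) - m) * weight b θ k) ≤
      ((k : ℝ) - m) * weight b θ'' k := by
    intro k
    have hwk := weight_nonneg hb hb0 hθ k
    have h1 : ((k : ℝ) - m) * ρ ^ m ≤ ((k : ℝ) - m) * ρ ^ k := by
      rw [← Real.rpow_natCast]
      rcases le_total m k with hk | hk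
      · exact mul_le_mul_of_nonneg_left (Real.rpow_le_rpow_of_exponent_le hρ1 hk) (by linarith)
      · exact mul_le_mul_of_nonpos_left (Real.rpow_le_rpow_of_exponent_le hρ1 hk) (by linarith)
    have h2 : 0 ≤ B b θ / B b θ'' * weight b θ k := by positivity
    have h3 := mul_le_mul_of_nonneg_left h1 h2
    rw [hw]
    linarith
  have h4 := Summable.tsum_le_tsum key
    ((summable_sub_mul_weight hb hθ m).mul_left _) (summable_sub_mul_weight hb hθ'' m)
  rw [tsum_mul_left, tsum_sub_mul_weight hb hb0 hθ, tsum_sub_mul_weight hb hb0 hθ'', ← hm, sub_self,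
    mul_zero] at h4
  linarith

lemma mean_eq_div (b : ℕ → ℝ) (θ : ℝ) :
    mean b θ = (∑' k : ℕ, (k : ℝ) * (b k * θ ^ k / (Nat.factorial k : ℝ))) / B b θ := by
  rw [mean, ← tsum_div_const]
  simp only [weight_eq, mul_div_assoc]

/-- The factor `k` removes the constant term, and `θ ^ k ≤ (θ / θ'') * θ'' ^ k` for `k ≥ 1`; the
denominator is at least `b 0`. The linear bound keeps `meanInv` away from `0`. -/
lemma mean_le_mul (hb : ∀ k, 0 ≤ b k) (hb0 : 0 < b 0) (hθ'' : θ'' ∈ params b) :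
    ∃ C, 0 < C ∧ ∀ θ, 0 < θ → θ ≤ θ'' → mean b θ ≤ C * θ := by
  have h'' := hθ''.1
  set A := ∑' k : ℕ, (k : ℝ) * (b k * θ'' ^ k / (Nat.factorial k : ℝ)) with hA
  have hs'' : Summable fun k : ℕ => (k : ℝ) * (b k * θ'' ^ k / (Nat.factorial k : ℝ)) := by
    simpa using summable_moment hb hθ'' 1
  have hA0 : 0 ≤ A := tsum_nonneg fun k => by
    have := hb k
    positivity
  refine ⟨A / θ'' / b 0 + 1, by positivity, fun θ h0 h => ?_⟩
  have hθ := mem_params_of_le hθ'' h0 h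
  have hs : Summable fun k : ℕ => (k : ℝ) * (b k * θ ^ k / (Nat.factorial k : ℝ)) := by
    simpa using summable_moment hb hθ 1
  have h1 : ∑' k : ℕ, (k : ℝ) * (b k * θ ^ k / (Nat.factorial k : ℝ)) ≤ θ / θ'' * A := by
    rw [hA, ← tsum_mul_left]
    refine Summable.tsum_le_tsum (fun k => ?_) hs (hs''.mul_left _)
    have hbk := hb k
    rcases Nat.eq_zero_or_pos k with rfl | hk
    · simp
    · obtain ⟨j, rfl⟩ : ∃ j, k = j + 1 := ⟨k - 1, by omega⟩
      have h2 : θ ^ j ≤ θ'' ^ j := by gcongr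
      have h3 : θ ^ (j + 1) ≤ θ / θ'' * θ'' ^ (j + 1) := by
        have h4 : θ / θ'' * θ'' ^ (j + 1) = θ * θ'' ^ j := by
          rw [pow_succ]
          field_simp
        rw [h4, pow_succ']
        gcongr
      calc ((j + 1 : ℕ) : ℝ) * (b (j + 1) * θ ^ (j + 1) / ((j + 1).factorial : ℝ))
          ≤ ((j + 1 : ℕ) : ℝ) * (b (j + 1) * (θ / θ'' * θ'' ^ (j + 1)) /
            ((j + 1).factorial : ℝ)) := by gcongr
        _ = _ := by ring
  rw [mean_eq_div]
  calc _ ≤ θ / θ'' * A / b 0 := by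
        gcongr
        exact le_B hb hθ
    _ = A / θ'' / b 0 * θ := by ring
    _ ≤ _ := by nlinarith

lemma continuousOn_mean (hb : ∀ k, 0 ≤ b k) (hb0 : 0 < b 0) (hθ'' : θ'' ∈ params b) (h' : 0 < θ') :
    ContinuousOn (mean b) (Set.Icc θ' θ'') := by
  have hs'' : Summable fun k : ℕ => (k : ℝ) * (b k * θ'' ^ k / (Nat.factorial k : ℝ)) := by
    simpa using summable_moment hb hθ'' 1
  have hbd : ∀ (k : ℕ), ∀ θ ∈ Set.Icc θ' θ'',
      ‖b k * θ ^ k / (Nat.factorial k : ℝ)‖ ≤ b k * θ'' ^ k / (Nat.factorial k : ℝ) := by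
    rintro k θ ⟨h1, h2⟩
    have := hb k
    have h0 : 0 < θ := h'.trans_le h1
    rw [Real.norm_of_nonneg (by positivity)]
    gcongr
  have hB : ContinuousOn (B b) (Set.Icc θ' θ'') :=
    continuousOn_tsum (fun k => by fun_prop) (summable_terms hb hθ'') hbd
  have hA : ContinuousOn (fun θ => ∑' k : ℕ, (k : ℝ) * (b k * θ ^ k / (Nat.factorial k : ℝ)))
      (Set.Icc θ' θ'') := by
    refine continuousOn_tsum (fun k => by fun_prop) hs'' fun k θ h => ?_
    rw [norm_mul, Real.norm_natCast]
    exact mul_le_mul_of_nonneg_left (hbd k θ h) (by positivity)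
  refine (hA.div hB fun θ h => ?_).congr fun θ _ => mean_eq_div b θ
  exact (B_pos hb hb0 (mem_params_of_le hθ'' (h'.trans_le h.1) h.2)).ne'

lemma exists_meanInv_bounds (hb : ∀ k, 0 ≤ b k) (hb0 : 0 < b 0) (hθ'' : θ'' ∈ params b) {α' : ℝ}
    (hα' : 0 < α') :
    ∃ θ', 0 < θ' ∧ ∀ α, α' < α → α < mean b θ'' →
      θ' ≤ meanInv b α ∧ meanInv b α ≤ θ'' ∧ mean b (meanInv b α) = α := by
  obtain ⟨C, hC, hle⟩ := mean_le_mul hb hb0 hθ''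
  have hθ0 := hθ''.1
  -- With this choice the mean at `θ'` is at most `C * θ' ≤ α'`, so the intermediate value theorem
  -- applies on `[θ', θ'']`.
  refine ⟨min θ'' (α' / C), by positivity, fun α h1 h2 => ?_⟩
  set θ' := min θ'' (α' / C) with hθ'
  have h0 : 0 < θ' := by positivity
  have hm' : mean b θ' ≤ α := by
    refine (hle θ' h0 (min_le_left _ _)).trans (le_trans ?_ h1.le)
    calc C * θ' ≤ C * (α' / C) := by
          gcongr
          exact min_le_right _ _
      _ = α' := by field_simp
  obtain ⟨θ, hθ, hθα⟩ := intermediate_value_Icc (min_le_left _ _ : θ' ≤ θ'')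
    (continuousOn_mean hb hb0 hθ'' h0) ⟨hm', h2.le⟩
  have hex : ∃ a ∈ params b, mean b a = α :=
    ⟨θ, mem_params_of_le hθ'' (h0.trans_le hθ.1) hθ.2, hθα⟩
  -- Existence of a preimage is enough: the bounds below hold for whichever preimage `invFunOn`
  -- selects, so weak monotonicity of the mean suffices.
  have hmem : meanInv b α ∈ params b := Function.invFunOn_mem hex
  have heq : mean b (meanInv b α) = α := Function.invFunOn_eq hex
  have hupper : meanInv b α ≤ θ'' := by
    by_contra hcon
    have := mean_mono hb hb0 hθ'' hmem (not_le.1 hcon).le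
    linarith
  refine ⟨?_, hupper, heq⟩
  refine (min_le_right _ _).trans ?_
  rw [div_le_iff₀ hC]
  have := hle _ hmem.1 hupper
  linarith

lemma le_weight (hb : ∀ k, 0 ≤ b k) (hb0 : 0 < b 0) (hθ'' : θ'' ∈ params b) (h' : 0 < θ')
    (h1 : θ' ≤ θ) (h2 : θ ≤ θ'') (k : ℕ) :
    b k * θ' ^ k / (Nat.factorial k : ℝ) / B b θ'' ≤ weight b θ k := by
  have hθ := mem_params_of_le hθ'' (h'.trans_le h1) h2
  have := hb k
  have := B_pos hb hb0 hθ
  have := B_pos hb hb0 hθ''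
  have := hθ.1
  rw [weight_eq]
  gcongr
  exact B_mono hb hθ hθ'' h2

/-- On a compact parameter interval every possible value has probability bounded away from `0`. -/
lemma exists_le_weight (hb : ∀ k, 0 ≤ b k) (hb0 : 0 < b 0) (hθ'' : θ'' ∈ params b) (h' : 0 < θ')
    {k : ℕ} (hk : 0 < b k) :
    ∃ δ, 0 < δ ∧ ∀ θ, θ' ≤ θ → θ ≤ θ'' → δ ≤ weight b θ k :=
  ⟨_, by have := B_pos hb hb0 hθ''; positivity, fun _ h1 h2 => le_weight hb hb0 hθ'' h' h1 h2 k⟩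

lemma weight_add_weight_le_one (hb : ∀ k, 0 ≤ b k) (hb0 : 0 < b 0) (hθ : θ ∈ params b) {j k : ℕ}
    (hjk : j ≠ k) : weight b θ j + weight b θ k ≤ 1 := by
  rw [← tsum_weight hb hb0 hθ, ← Finset.sum_pair hjk]
  exact (summable_weight hb hθ).sum_le_tsum _ fun i _ => weight_nonneg hb hb0 hθ i

lemma exists_moment_le (hb : ∀ k, 0 ≤ b k) (hb0 : 0 < b 0) (hθ'' : θ'' ∈ params b) (r : ℕ) :
    ∃ M, ∀ θ, 0 < θ → θ ≤ θ'' → ∑' k : ℕ, (k : ℝ) ^ r * weight b θ k ≤ M := by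
  refine ⟨(∑' k : ℕ, (k : ℝ) ^ r * (b k * θ'' ^ k / (Nat.factorial k : ℝ))) / b 0,
    fun θ h0 h => ?_⟩
  have hθ := mem_params_of_le hθ'' h0 h
  have h1 : ∑' k : ℕ, (k : ℝ) ^ r * weight b θ k =
      (∑' k : ℕ, (k : ℝ) ^ r * (b k * θ ^ k / (Nat.factorial k : ℝ))) / B b θ := by
    rw [← tsum_div_const]
    simp only [weight_eq, mul_div_assoc]
  rw [h1]
  have h2 : ∑' k : ℕ, (k : ℝ) ^ r * (b k * θ ^ k / (Nat.factorial k : ℝ)) ≤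
      ∑' k : ℕ, (k : ℝ) ^ r * (b k * θ'' ^ k / (Nat.factorial k : ℝ)) := by
    refine Summable.tsum_le_tsum (fun k => ?_) (summable_moment hb hθ r)
      (summable_moment hb hθ'' r)
    have := hb k
    gcongr
  have h3 : 0 ≤ ∑' k : ℕ, (k : ℝ) ^ r * (b k * θ'' ^ k / (Nat.factorial k : ℝ)) :=
    tsum_nonneg fun k => by
      have := hb k
      have := hθ''.1
      positivity
  exact div_le_div₀ h3 h2 hb0 (le_B hb hθ)

end PowerSeries

/-! ### A uniform lower bound in the local limit theorem, by Fourier inversion. -/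

section LocalLimit

open Complex in
-- Taylor's formula for `|y| ≤ 1`; for larger `|y|` the triangle inequality gives `2 + |y| + |y| ^ 2
-- / 2`, which the generous constant 4 covers.
lemma norm_exp_sub_quadratic_le (y : ℝ) :
    ‖cexp (I * y) - (1 + I * y - (y : ℂ) ^ 2 / 2)‖ ≤ 4 * |y| ^ 3 := by
  have hn : ‖I * (y : ℂ)‖ = |y| := by simp
  rcases le_total |y| 1 with h | h
  · have h1 := Complex.exp_bound (x := I * y) (by rw [hn]; exact h) (n := 3) (by norm_num)
    have h2 : ∑ m ∈ Finset.range 3, (I * (y : ℂ)) ^ m / (m.factorial : ℂ) =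
        1 + I * y - (y : ℂ) ^ 2 / 2 := by
      simp [Finset.sum_range_succ, mul_pow, Nat.factorial]
      ring
    rw [h2, hn] at h1
    refine h1.trans ?_
    have : 0 ≤ |y| ^ 3 := by positivity
    norm_num [Nat.factorial]
    linarith
  · have h1 : ‖cexp (I * y)‖ = 1 := by rw [mul_comm]; exact norm_exp_ofReal_mul_I y
    have h2 : ‖(y : ℂ) ^ 2 / 2‖ = |y| ^ 2 / 2 := by simp
    calc _ ≤ ‖cexp (I * y)‖ + (‖(1 : ℂ)‖ + ‖I * (y : ℂ)‖ + ‖(y : ℂ) ^ 2 / 2‖) :=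
          (norm_sub_le _ _).trans (add_le_add_right
            ((norm_sub_le _ _).trans (add_le_add_left (norm_add_le _ _) _)) _)
      _ = 2 + |y| + |y| ^ 2 / 2 := by rw [h1, h2, hn, norm_one]; ring
      _ ≤ 4 * |y| ^ 3 := by
          nlinarith [sq_nonneg (|y| - 1), pow_le_pow_right₀ h (show 1 ≤ 3 by norm_num),
            pow_le_pow_right₀ h (show 2 ≤ 3 by norm_num),
            pow_le_pow_right₀ h (show 0 ≤ 3 by norm_num)]

lemma abs_exp_neg_sub_le {x : ℝ} (hx : 0 ≤ x) : |Real.exp (-x) - (1 - x)| ≤ x ^ 2 := by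
  have h1 := Real.add_one_le_exp (-x)
  have h2 := Real.add_one_le_exp x
  have h3 : Real.exp (-x) ≤ 1 - x + x ^ 2 := by
    rw [Real.exp_neg, inv_le_iff_one_le_mul₀ (Real.exp_pos x)]
    have : 0 ≤ 1 - x + x ^ 2 := by nlinarith [sq_nonneg (x - 1)]
    nlinarith [mul_le_mul_of_nonneg_left h2 this, pow_nonneg hx 3]
  rw [abs_le]
  constructor <;> nlinarith [sq_nonneg x]

/-- Telescoping. Keeping `R ^ n` matters: with `R` a Gaussian envelope, the error retains Gaussian
decay. -/
lemma norm_pow_succ_sub_pow_succ_le {a c : ℂ} {R : ℝ} (ha : ‖a‖ ≤ R) (hc : ‖c‖ ≤ R) (n : ℕ) :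
    ‖a ^ (n + 1) - c ^ (n + 1)‖ ≤ (n + 1) * R ^ n * ‖a - c‖ := by
  have hR : 0 ≤ R := (norm_nonneg a).trans ha
  induction n with
  | zero => simp
  | succ n ih =>
    have : a ^ (n + 1 + 1) - c ^ (n + 1 + 1) =
        a * (a ^ (n + 1) - c ^ (n + 1)) + (a - c) * c ^ (n + 1) := by ring
    rw [this]
    calc _ ≤ ‖a‖ * ‖a ^ (n + 1) - c ^ (n + 1)‖ + ‖a - c‖ * ‖c‖ ^ (n + 1) := by
          refine (norm_add_le _ _).trans_eq ?_
          rw [norm_mul, norm_mul, norm_pow]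
      _ ≤ R * ((n + 1) * R ^ n * ‖a - c‖) + ‖a - c‖ * R ^ (n + 1) := by gcongr
      _ = _ := by push_cast; ring

lemma integral_cube_mul_exp_le {β L : ℝ} (hβ : 0 < β) :
    ∫ t in (0 : ℝ)..L, t ^ 3 * Real.exp (-(β * t ^ 2)) ≤ 1 / (2 * β ^ 2) := by
  have hd : ∀ t : ℝ, HasDerivAt
      (fun t => -((t ^ 2 / (2 * β) + 1 / (2 * β ^ 2)) * Real.exp (-(β * t ^ 2))))
      (t ^ 3 * Real.exp (-(β * t ^ 2))) t := by
    intro t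
    have h1 : HasDerivAt (fun t : ℝ => t ^ 2) (2 * t) t := by simpa using hasDerivAt_pow 2 t
    have h2 : HasDerivAt (fun t : ℝ => Real.exp (-(β * t ^ 2)))
        (Real.exp (-(β * t ^ 2)) * (-(β * (2 * t)))) t := ((h1.const_mul β).neg).exp
    convert! ((((h1.div_const (2 * β)).add_const (1 / (2 * β ^ 2))).mul h2).neg) using 1
    field_simp
    ring
  rw [intervalIntegral.integral_eq_sub_of_hasDerivAt (fun t _ => hd t)
    (Continuous.intervalIntegrable (by fun_prop) _ _)]
  have : 0 ≤ (L ^ 2 / (2 * β) + 1 / (2 * β ^ 2)) * Real.exp (-(β * L ^ 2)) := by positivity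
  simp
  simp at this
  linarith

/-- Inversion over half a period: only real parts are used, and these are even in `t`. -/
lemma integral_cos_mul_intCast (j : ℤ) :
    ∫ t in (0 : ℝ)..Real.pi, Real.cos (t * j) = if j = 0 then Real.pi else 0 := by
  split_ifs with h
  · simp [h]
  · have hj : (j : ℝ) ≠ 0 := by exact_mod_cast h
    rw [intervalIntegral.integral_comp_mul_right _ hj, integral_cos, mul_comm Real.pi,
      Real.sin_int_mul_pi]
    simp

/-- The characteristic function of the law `ν` centred at `m`. -/
noncomputable def centredCharFun (ν : Measure ℕ) (m t : ℝ) : ℂ :=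
  ∫ k : ℕ, Complex.exp (Complex.I * ((t * ((k : ℝ) - m) : ℝ) : ℂ)) ∂ν

lemma norm_exp_I_mul (y : ℝ) : ‖Complex.exp (Complex.I * (y : ℂ))‖ = 1 := by
  rw [mul_comm]
  exact Complex.norm_exp_ofReal_mul_I y

lemma integrable_of_norm_le_const {α E : Type*} [MeasurableSpace α] [MeasurableSingletonClass α]
    [Countable α] [NormedAddCommGroup E] {μ : Measure α} [IsFiniteMeasure μ] {f : α → E} (C : ℝ)
    (hf : ∀ x, ‖f x‖ ≤ C) : Integrable f μ :=
  Integrable.of_bound (StronglyMeasurable.of_discrete).aestronglyMeasurable C (ae_of_all _ hf)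

lemma hasSum_measureReal_singleton (ν : Measure ℕ) [IsProbabilityMeasure ν] :
    HasSum (fun k : ℕ => ν.real {k}) 1 := by
  have h := hasSum_integral_measure (μ := fun k : ℕ => ν {k} • Measure.dirac k)
    (f := fun _ : ℕ => (1 : ℝ)) (by rw [Measure.sum_smul_dirac]; exact integrable_const 1)
  rw [Measure.sum_smul_dirac] at h
  simpa [measureReal_def] using h

/-- Taking out the phase of the midpoint leaves `2 cos (t / 2)`, and `cos x ≤ 1 - 2 x² / π²` on the
range in question. -/
lemma norm_exp_add_exp_le {t : ℝ} (h0 : 0 ≤ t) (h1 : t ≤ Real.pi) (a : ℝ) :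
    ‖Complex.exp (Complex.I * (a : ℂ)) + Complex.exp (Complex.I * ((a + t : ℝ) : ℂ))‖ ≤
      2 - t ^ 2 / Real.pi ^ 2 := by
  have hpi := Real.pi_pos
  have h : Complex.exp (Complex.I * (a : ℂ)) + Complex.exp (Complex.I * ((a + t : ℝ) : ℂ)) =
      Complex.exp (Complex.I * ((a + t / 2 : ℝ) : ℂ)) * ((2 * Real.cos (t / 2) : ℝ) : ℂ) := by
    push_cast
    rw [Complex.two_cos, mul_add (Complex.exp _), ← Complex.exp_add, ← Complex.exp_add, add_comm]
    congr 2 <;> ring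
  have hc := Real.cos_le_one_sub_mul_cos_sq (x := t / 2) (by rw [abs_of_nonneg] <;> linarith)
  have hc0 : 0 ≤ Real.cos (t / 2) := Real.cos_nonneg_of_mem_Icc ⟨by linarith, by linarith⟩
  rw [h, norm_mul, norm_exp_I_mul, one_mul, Complex.norm_real, Real.norm_of_nonneg (by positivity)]
  have : 2 / Real.pi ^ 2 * (t / 2) ^ 2 = t ^ 2 / Real.pi ^ 2 / 2 := by ring
  linarith

/-- The adjacent atoms `0` and `1`, each of mass at least `r`, interfere destructively on all of
`(0, π]`; the remaining mass is bounded trivially. This gives a Gaussian envelope on the whole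
interval, so the integral need not be split into central and outer parts. -/
lemma norm_centredCharFun_le (ν : Measure ℕ) [IsProbabilityMeasure ν] {r : ℝ} (hr : 0 ≤ r)
    (h0 : r ≤ ν.real {0}) (h1 : r ≤ ν.real {1}) (m : ℝ) {t : ℝ} (ht0 : 0 ≤ t)
    (ht1 : t ≤ Real.pi) :
    ‖centredCharFun ν m t‖ ≤ Real.exp (-(r / Real.pi ^ 2 * t ^ 2)) := by
  set f : ℕ → ℂ := fun k => Complex.exp (Complex.I * ((t * ((k : ℝ) - m) : ℝ) : ℂ)) with hf
  have hfn : ∀ k, ‖f k‖ = 1 := fun k => norm_exp_I_mul _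
  have hw := hasSum_measureReal_singleton ν
  have hws : Summable fun k : ℕ => ν.real {k} := hw.summable
  have hn : ∀ k, ‖ν.real {k} • f k‖ = ν.real {k} := fun k => by
    rw [norm_smul, hfn, mul_one, Real.norm_of_nonneg measureReal_nonneg]
  have hfs : Summable fun k : ℕ => ν.real {k} • f k := by
    refine Summable.of_norm ?_
    simpa only [hn] using hws
  have hint : centredCharFun ν m t = ∑' k, ν.real {k} • f k :=
    integral_countable (integrable_of_norm_le_const 1 fun k => (hfn k).le)
  have e1 := hfs.sum_add_tsum_nat_add 2
  have e2 := hws.sum_add_tsum_nat_add 2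
  rw [hw.tsum_eq] at e2
  simp only [Finset.sum_range_succ, Finset.sum_range_zero, zero_add] at e1 e2
  have e3 : ‖∑' k, ν.real {k + 2} • f (k + 2)‖ ≤ ∑' k, ν.real {k + 2} := by
    refine tsum_of_norm_bounded ((summable_nat_add_iff 2).2 hws).hasSum fun k => (hn _).le
  have e4 : ‖f 0 + f 1‖ ≤ 2 - t ^ 2 / Real.pi ^ 2 := by
    have := norm_exp_add_exp_le ht0 ht1 (t * (0 - m))
    rw [hf]
    convert this using 5 <;> (push_cast; ring)
  have e5 : ν.real {0} • f 0 + ν.real {1} • f 1 =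
      (ν.real {0} - r) • f 0 + (ν.real {1} - r) • f 1 + r • (f 0 + f 1) := by
    simp only [sub_smul, smul_add]
    abel
  have e6 : ‖ν.real {0} • f 0 + ν.real {1} • f 1‖ ≤
      (ν.real {0} - r) + (ν.real {1} - r) + r * (2 - t ^ 2 / Real.pi ^ 2) := by
    rw [e5]
    refine (norm_add₃_le).trans ?_
    rw [norm_smul, norm_smul, norm_smul, hfn, hfn, Real.norm_of_nonneg (by linarith),
      Real.norm_of_nonneg (by linarith), Real.norm_of_nonneg hr, mul_one, mul_one]
    gcongr
  rw [hint, ← e1]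
  refine (norm_add_le _ _).trans ?_
  have e7 := Real.add_one_le_exp (-(r / Real.pi ^ 2 * t ^ 2))
  have e8 : r / Real.pi ^ 2 * t ^ 2 = r * (t ^ 2 / Real.pi ^ 2) := by ring
  rw [e8] at e7 ⊢
  nlinarith

lemma integrable_pow_of_integrable_cube {ν : Measure ℕ} [IsProbabilityMeasure ν] {m : ℝ}
    (h : Integrable (fun k : ℕ => |(k : ℝ) - m| ^ 3) ν) {r : ℕ} (hr : r ≤ 3) :
    Integrable (fun k : ℕ => ((k : ℝ) - m) ^ r) ν := by
  refine ((integrable_const (1 : ℝ)).add h).mono'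
    (StronglyMeasurable.of_discrete).aestronglyMeasurable (ae_of_all _ fun k => ?_)
  rw [norm_pow, Real.norm_eq_abs, Pi.add_apply]
  rcases le_total |(k : ℝ) - m| 1 with h1 | h1
  · have := pow_le_one₀ (n := r) (abs_nonneg _) h1
    have : 0 ≤ |(k : ℝ) - m| ^ 3 := by positivity
    linarith
  · have := pow_le_pow_right₀ h1 hr
    linarith

lemma integral_sq_le_one_add {ν : Measure ℕ} [IsProbabilityMeasure ν] {m : ℝ}
    (h : Integrable (fun k : ℕ => |(k : ℝ) - m| ^ 3) ν) :
    ∫ k : ℕ, ((k : ℝ) - m) ^ 2 ∂ν ≤ 1 + ∫ k : ℕ, |(k : ℝ) - m| ^ 3 ∂ν := by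
  have h2 : ∫ k : ℕ, (1 + |(k : ℝ) - m| ^ 3) ∂ν = 1 + ∫ k : ℕ, |(k : ℝ) - m| ^ 3 ∂ν := by
    rw [integral_add (integrable_const _) h]
    simp
  rw [← h2]
  refine integral_mono (integrable_pow_of_integrable_cube h (by norm_num))
    ((integrable_const _).add h) fun k => ?_
  rw [← sq_abs]
  rcases le_total |(k : ℝ) - m| 1 with h1 | h1
  · have := pow_le_one₀ (n := 2) (abs_nonneg _) h1
    have : 0 ≤ |(k : ℝ) - m| ^ 3 := by positivity
    linarith
  · have := pow_le_pow_right₀ h1 (show 2 ≤ 3 by norm_num)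
    linarith

/-- The atoms at `0` and `1` alone contribute `r * (m ^ 2 + (1 - m) ^ 2) ≥ r / 2`. -/
lemma half_le_integral_sq {ν : Measure ℕ} [IsProbabilityMeasure ν] {m r : ℝ}
    (h : Integrable (fun k : ℕ => |(k : ℝ) - m| ^ 3) ν) (hr : 0 ≤ r)
    (h0 : r ≤ ν.real {0}) (h1 : r ≤ ν.real {1}) :
    r / 2 ≤ ∫ k : ℕ, ((k : ℝ) - m) ^ 2 ∂ν := by
  have hi := integrable_pow_of_integrable_cube h (show 2 ≤ 3 by norm_num)
  have hs : HasSum (fun k : ℕ => ν.real {k} • ((k : ℝ) - m) ^ 2)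
      (∫ k : ℕ, ((k : ℝ) - m) ^ 2 ∂ν) := by
    have hi' := hi
    rw [← Measure.sum_smul_dirac ν] at hi'
    have := hasSum_integral_measure hi'
    rw [Measure.sum_smul_dirac] at this
    simpa [measureReal_def] using this
  have h2 := sum_le_hasSum (Finset.range 2) (fun k _ => by positivity) hs
  simp only [Finset.sum_range_succ, Finset.sum_range_zero, zero_add, smul_eq_mul, Nat.cast_zero,
    Nat.cast_one] at h2
  nlinarith [mul_le_mul_of_nonneg_right h0 (sq_nonneg (0 - m)),
    mul_le_mul_of_nonneg_right h1 (sq_nonneg (1 - m)), mul_nonneg hr (sq_nonneg (1 - 2 * m))]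

/-- Both terms are compared with `1 - v t² / 2`. The Gaussian's error is of order `t ^ 4`, and one
factor `t ≤ π` is given away to have `t ^ 3` throughout. -/
lemma norm_centredCharFun_sub_le {ν : Measure ℕ} [IsProbabilityMeasure ν] {m : ℝ}
    (h : Integrable (fun k : ℕ => |(k : ℝ) - m| ^ 3) ν) (hm : ∫ k : ℕ, ((k : ℝ) - m) ∂ν = 0)
    {t : ℝ} (ht0 : 0 ≤ t) (ht1 : t ≤ Real.pi) :
    ‖centredCharFun ν m t -
        (Real.exp (-((∫ k : ℕ, ((k : ℝ) - m) ^ 2 ∂ν) * t ^ 2 / 2)) : ℂ)‖ ≤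
      (4 * (∫ k : ℕ, |(k : ℝ) - m| ^ 3 ∂ν) +
        (∫ k : ℕ, ((k : ℝ) - m) ^ 2 ∂ν) ^ 2 * Real.pi / 4) * t ^ 3 := by
  set v := ∫ k : ℕ, ((k : ℝ) - m) ^ 2 ∂ν with hv
  have hv0 : 0 ≤ v := integral_nonneg fun k => sq_nonneg _
  have i1 : Integrable (fun k : ℕ => ((k : ℝ) - m)) ν := by
    simpa using integrable_pow_of_integrable_cube h (show 1 ≤ 3 by norm_num)
  have i2 := integrable_pow_of_integrable_cube h (show 2 ≤ 3 by norm_num)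
  set g : ℕ → ℂ := fun k => 1 + Complex.I * ((t * ((k : ℝ) - m) : ℝ) : ℂ) -
    ((t * ((k : ℝ) - m) : ℝ) : ℂ) ^ 2 / 2 with hg
  have j1 : Integrable (fun k : ℕ => Complex.I * ((t * ((k : ℝ) - m) : ℝ) : ℂ)) ν :=
    ((i1.const_mul t).ofReal).const_mul _
  have j2 : Integrable (fun k : ℕ => ((t * ((k : ℝ) - m) : ℝ) : ℂ) ^ 2 / 2) ν := by
    have hk : ∀ k : ℕ, ((t ^ 2 / 2 * ((k : ℝ) - m) ^ 2 : ℝ) : ℂ) =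
        ((t * ((k : ℝ) - m) : ℝ) : ℂ) ^ 2 / 2 := fun k => by
      push_cast
      ring
    exact ((i2.const_mul (t ^ 2 / 2)).ofReal (𝕜 := ℂ)).congr (ae_of_all _ hk)
  have hgi : Integrable g ν := ((integrable_const (1 : ℂ)).add j1).sub j2
  have hgint : ∫ k, g k ∂ν = ((1 - v * t ^ 2 / 2 : ℝ) : ℂ) := by
    have a1 : ∫ k : ℕ, Complex.I * ((t * ((k : ℝ) - m) : ℝ) : ℂ) ∂ν = 0 := by
      rw [integral_const_mul, integral_complex_ofReal, integral_const_mul, hm]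
      simp
    have a2 : ∫ k : ℕ, ((t * ((k : ℝ) - m) : ℝ) : ℂ) ^ 2 / 2 ∂ν = ((v * t ^ 2 / 2 : ℝ) : ℂ) := by
      have : ∀ k : ℕ, ((t * ((k : ℝ) - m) : ℝ) : ℂ) ^ 2 / 2 =
          ((t ^ 2 / 2 * ((k : ℝ) - m) ^ 2 : ℝ) : ℂ) := fun k => by
        push_cast
        ring
      simp only [this]
      rw [integral_complex_ofReal, integral_const_mul, ← hv]
      congr 1
      ring
    have a3 := integral_sub ((integrable_const (1 : ℂ)).add j1) j2
    have a4 := integral_add (integrable_const (1 : ℂ)) j1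
    simp only [Pi.add_apply] at a3
    refine a3.trans ?_
    rw [a4, a1, a2]
    simp
  have hfi : Integrable (fun k : ℕ => Complex.exp (Complex.I * ((t * ((k : ℝ) - m) : ℝ) : ℂ))) ν :=
    integrable_of_norm_le_const 1 fun k => (norm_exp_I_mul _).le
  have b1 : ‖centredCharFun ν m t - ((1 - v * t ^ 2 / 2 : ℝ) : ℂ)‖ ≤
      4 * (∫ k : ℕ, |(k : ℝ) - m| ^ 3 ∂ν) * t ^ 3 := by
    rw [← hgint, centredCharFun, ← integral_sub hfi hgi]
    refine (norm_integral_le_of_norm_le (h.const_mul (4 * t ^ 3)) (ae_of_all _ fun k => ?_)).trans_eq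
      ?_
    · refine (norm_exp_sub_quadratic_le _).trans_eq ?_
      rw [abs_mul, abs_of_nonneg ht0]
      ring
    · rw [integral_const_mul]
      ring
  have b2 : ‖((1 - v * t ^ 2 / 2 : ℝ) : ℂ) - (Real.exp (-(v * t ^ 2 / 2)) : ℂ)‖ ≤
      v ^ 2 * Real.pi / 4 * t ^ 3 := by
    rw [← Complex.ofReal_sub, Complex.norm_real, Real.norm_eq_abs, abs_sub_comm]
    refine (abs_exp_neg_sub_le (by positivity)).trans ?_
    have : v ^ 2 * t ^ 3 / 4 * t ≤ v ^ 2 * t ^ 3 / 4 * Real.pi := by gcongr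
    calc _ = v ^ 2 * t ^ 3 / 4 * t := by ring
      _ ≤ _ := this
      _ = _ := by ring
  refine (norm_sub_le_norm_sub_add_norm_sub _ ((1 - v * t ^ 2 / 2 : ℝ) : ℂ) _).trans ?_
  rw [add_mul]
  exact add_le_add b1 b2

/-- The power is the characteristic function of the centred sum. As `N * m = n` is an integer, the
centred sum is integer valued, and the inversion formula picks out the event that it is `0`. -/
lemma integral_re_centredCharFun_pow (ν : Measure ℕ) [IsProbabilityMeasure ν] {N n : ℕ} {m : ℝ}
    (hm : N * m = n) :
    ∫ t in (0 : ℝ)..Real.pi, (centredCharFun ν m t ^ N).re =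
      Real.pi * (Measure.pi fun _ : Fin N => ν).real {x | ∑ j, x j = n} := by
  set μ := Measure.pi fun _ : Fin N => ν with hμ
  have h1 : ∀ t : ℝ, (centredCharFun ν m t ^ N).re =
      ∫ x, Real.cos (t * (((∑ j, x j : ℕ) : ℤ) - (n : ℤ) : ℤ)) ∂μ := by
    intro t
    have h2 : centredCharFun ν m t ^ N = ∫ x, Complex.exp
        (Complex.I * ((t * (((∑ j, x j : ℕ) : ℤ) - (n : ℤ) : ℤ) : ℝ) : ℂ)) ∂μ := by
      have h3 := integral_fintype_prod_eq_pow (ι := Fin N) (μ := ν) (𝕜 := ℂ)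
        (fun k : ℕ => Complex.exp (Complex.I * ((t * ((k : ℝ) - m) : ℝ) : ℂ)))
      rw [Fintype.card_fin] at h3
      rw [centredCharFun, ← h3]
      refine integral_congr_ae (ae_of_all _ fun x => ?_)
      simp only
      rw [← Complex.exp_sum, ← Finset.mul_sum, ← Complex.ofReal_sum, ← Finset.mul_sum,
        Finset.sum_sub_distrib, Finset.sum_const, Finset.card_univ, Fintype.card_fin, nsmul_eq_mul,
        hm]
      push_cast
      rfl
    rw [h2]
    have h4 : Integrable (fun x : Fin N → ℕ => Complex.exp
        (Complex.I * ((t * (((∑ j, x j : ℕ) : ℤ) - (n : ℤ) : ℤ) : ℝ) : ℂ))) μ :=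
      integrable_of_norm_le_const 1 fun x => (norm_exp_I_mul _).le
    have h5 := integral_re h4
    refine h5.symm.trans (integral_congr_ae (ae_of_all _ fun x => ?_))
    simp only [RCLike.re_eq_complex_re]
    rw [mul_comm Complex.I, Complex.exp_ofReal_mul_I_re]
  simp only [h1]
  rw [intervalIntegral.integral_of_le Real.pi_pos.le, integral_integral_swap]
  · have h6 : ∀ x : Fin N → ℕ,
        ∫ t in Set.Ioc 0 Real.pi, Real.cos (t * (((∑ j, x j : ℕ) : ℤ) - (n : ℤ) : ℤ)) =
          Set.indicator {x : Fin N → ℕ | ∑ j, x j = n} (fun _ => Real.pi) x := by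
      intro x
      rw [← intervalIntegral.integral_of_le Real.pi_pos.le, integral_cos_mul_intCast,
        Set.indicator_apply]
      refine if_congr ?_ rfl rfl
      rw [sub_eq_zero, Set.mem_ofPred_eq]
      exact Nat.cast_inj
    simp only [h6]
    rw [integral_indicator_const _ (MeasurableSet.of_discrete), smul_eq_mul, mul_comm]
  · refine Integrable.of_bound (C := 1) ?_ (ae_of_all _ fun p => ?_)
    · refine Measurable.aestronglyMeasurable ?_
      refine Real.measurable_cos.comp (measurable_fst.mul ?_)
      exact (Measurable.of_discrete (f := fun x : Fin N → ℕ =>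
        ((((∑ j, x j : ℕ) : ℤ) - (n : ℤ) : ℤ) : ℝ))).comp measurable_snd
    · exact Real.abs_cos_le_one _

/-- A quantitative form of the lower bound in the local limit theorem. -/
lemma le_pi_mul_measureReal_sum_eq {ν : Measure ℕ} [IsProbabilityMeasure ν] {r M m : ℝ}
    (hr : 0 < r) (h0 : r ≤ ν.real {0}) (h1 : r ≤ ν.real {1})
    (h : Integrable (fun k : ℕ => |(k : ℝ) - m| ^ 3) ν) (hm : ∫ k : ℕ, ((k : ℝ) - m) ∂ν = 0)
    (hM : ∫ k : ℕ, |(k : ℝ) - m| ^ 3 ∂ν ≤ M) {N n : ℕ} (hN : 0 < N) (hNm : (N + 1 : ℕ) * m = n) :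
    Real.exp (-((1 + M) / 2)) / √(N + 1) -
        (N + 1) * ((4 * M + (1 + M) ^ 2 * Real.pi / 4) / (2 * (r / Real.pi ^ 2 * N) ^ 2)) ≤
      Real.pi * (Measure.pi fun _ : Fin (N + 1) => ν).real {x | ∑ j, x j = n} := by
  set v := ∫ k : ℕ, ((k : ℝ) - m) ^ 2 ∂ν with hv
  have hpi := Real.pi_pos
  have hv0 : 0 ≤ v := integral_nonneg fun k => sq_nonneg _
  have hM0 : 0 ≤ M := le_trans (integral_nonneg fun k => by positivity) hM
  have hvM : v ≤ 1 + M := (integral_sq_le_one_add h).trans (by linarith)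
  have hvr : r / 2 ≤ v := half_le_integral_sq h hr.le h0 h1
  set C := 4 * M + (1 + M) ^ 2 * Real.pi / 4 with hC
  have hC0 : 0 ≤ C := by positivity
  set c := r / Real.pi ^ 2 with hc
  have hc0 : 0 < c := by positivity
  -- Ensures that the Gaussian `exp (-v t² / 2)` lies under the same envelope `exp (-c t²)` as the
  -- characteristic function.
  have hcv : c ≤ v / 2 := by
    refine le_trans ?_ (show r / 4 ≤ v / 2 by linarith)
    rw [hc]
    gcongr
    nlinarith [Real.pi_gt_three]
  rw [← integral_re_centredCharFun_pow ν hNm]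
  have hN' : (0 : ℝ) < N := by exact_mod_cast hN
  have hβ : 0 < c * N := by positivity
  have key : ∀ t ∈ Set.Icc 0 Real.pi,
      Real.exp (-(v * t ^ 2 / 2)) ^ (N + 1) -
        (N + 1) * C * (t ^ 3 * Real.exp (-(c * N * t ^ 2))) ≤
      (centredCharFun ν m t ^ (N + 1)).re := by
    rintro t ⟨ht0, ht1⟩
    have a1 := norm_centredCharFun_le ν hr.le h0 h1 m ht0 ht1
    have a2 : ‖(Real.exp (-(v * t ^ 2 / 2)) : ℂ)‖ ≤ Real.exp (-(c * t ^ 2)) := by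
      rw [Complex.norm_real, Real.norm_of_nonneg (Real.exp_pos _).le, Real.exp_le_exp]
      nlinarith [mul_le_mul_of_nonneg_right hcv (sq_nonneg t)]
    have a3 := norm_pow_succ_sub_pow_succ_le a1 a2 N
    have a4 : ‖centredCharFun ν m t - (Real.exp (-(v * t ^ 2 / 2)) : ℂ)‖ ≤ C * t ^ 3 := by
      refine (norm_centredCharFun_sub_le h hm ht0 ht1).trans ?_
      rw [hC]
      gcongr
    have a5 : Real.exp (-(c * t ^ 2)) ^ N = Real.exp (-(c * N * t ^ 2)) := by
      rw [← Real.exp_nat_mul]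
      congr 1
      ring
    have a6 : ‖centredCharFun ν m t ^ (N + 1) - (Real.exp (-(v * t ^ 2 / 2)) : ℂ) ^ (N + 1)‖ ≤
        (N + 1) * C * (t ^ 3 * Real.exp (-(c * N * t ^ 2))) := by
      refine a3.trans ?_
      rw [a5]
      calc _ ≤ (N + 1) * Real.exp (-(c * N * t ^ 2)) * (C * t ^ 3) := by gcongr
        _ = _ := by ring
    have a7 := (abs_le.1 ((Complex.abs_re_le_norm _).trans a6)).1
    have a8 : ((Real.exp (-(v * t ^ 2 / 2)) : ℂ) ^ (N + 1)).re =
        Real.exp (-(v * t ^ 2 / 2)) ^ (N + 1) := by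
      rw [← Complex.ofReal_pow, Complex.ofReal_re]
    rw [Complex.sub_re, a8] at a7
    linarith
  have hcont : Continuous fun t => (centredCharFun ν m t ^ (N + 1)).re := by
    have : Continuous (centredCharFun ν m) := by
      refine continuous_of_dominated (bound := fun _ => 1)
        (fun t => (StronglyMeasurable.of_discrete).aestronglyMeasurable)
        (fun t => ae_of_all _ fun k => (norm_exp_I_mul _).le) (integrable_const _)
        (ae_of_all _ fun k => ?_)
      fun_prop
    exact Complex.continuous_re.comp (this.pow _)
  have c1 : Continuous fun t : ℝ => Real.exp (-(v * t ^ 2 / 2)) ^ (N + 1) := by fun_prop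
  have c2 : Continuous fun t : ℝ => (N + 1) * C * (t ^ 3 * Real.exp (-(c * N * t ^ 2))) := by
    fun_prop
  have hle := intervalIntegral.integral_mono_on (μ := volume) hpi.le
    ((c1.sub c2).intervalIntegrable 0 Real.pi) (hcont.intervalIntegrable 0 Real.pi) key
  refine le_trans ?_ hle
  simp only [Pi.sub_apply]
  rw [intervalIntegral.integral_sub (c1.intervalIntegrable _ _) (c2.intervalIntegrable _ _),
    intervalIntegral.integral_const_mul]
  refine sub_le_sub ?_ ?_
  -- The main term: only `[0, 1 / √(N + 1)]` is kept, where the integrand is at least `exp (-v / 2)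
  -- ≥ exp (-(1 + M) / 2)`.
  · have hs : 0 < √((N : ℝ) + 1) := by positivity
    have hs1 : 1 / √((N : ℝ) + 1) ≤ Real.pi := by
      have : 1 ≤ √((N : ℝ) + 1) := Real.one_le_sqrt.2 (by linarith)
      have : 1 / √((N : ℝ) + 1) ≤ 1 := by
        rw [div_le_one hs]
        exact this
      linarith [Real.pi_gt_three]
    have d1 := intervalIntegral.integral_mono_interval (μ := volume) (le_refl (0 : ℝ))
      (show 0 ≤ 1 / √((N : ℝ) + 1) by positivity) hs1
      (ae_of_all _ fun t => show (0 : ℝ) ≤ Real.exp (-(v * t ^ 2 / 2)) ^ (N + 1) by positivity)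
      (c1.intervalIntegrable _ _)
    refine le_trans ?_ d1
    have d2 := intervalIntegral.integral_mono_on (μ := volume)
      (f := fun _ => Real.exp (-((1 + M) / 2)))
      (show 0 ≤ 1 / √((N : ℝ) + 1) by positivity) (continuous_const.intervalIntegrable _ _)
      (c1.intervalIntegrable _ _) (fun t ht => by
        rw [← Real.exp_nat_mul, Real.exp_le_exp]
        have e1 : t ^ 2 ≤ 1 / ((N : ℝ) + 1) := by
          have := pow_le_pow_left₀ ht.1 ht.2 2
          rwa [div_pow, one_pow, Real.sq_sqrt (by positivity)] at this
        have e2 : ((N : ℝ) + 1) * t ^ 2 ≤ 1 := by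
          rw [le_div_iff₀ (by positivity)] at e1
          linarith
        push_cast
        nlinarith [mul_le_mul_of_nonneg_left e2 hv0])
    refine le_trans (le_of_eq ?_) d2
    rw [intervalIntegral.integral_const]
    simp
    ring
  · rw [mul_assoc]
    refine mul_le_mul_of_nonneg_left ?_ (by positivity)
    calc _ ≤ C * (1 / (2 * (c * N) ^ 2)) :=
          mul_le_mul_of_nonneg_left (integral_cube_mul_exp_le hβ) hC0
      _ = _ := by ring

/-- The lower bound in the local limit theorem at the mean, uniform over the laws with a given
bound on the third moment and with a given part of the mass at `0` and at `1`. -/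
theorem exists_le_measureReal_sum_eq {r : ℝ} (hr : 0 < r) (M : ℝ) :
    ∃ c : ℝ, 0 < c ∧ ∃ N₀ : ℕ, ∀ (ν : Measure ℕ) [IsProbabilityMeasure ν] (m : ℝ),
      r ≤ ν.real {0} → r ≤ ν.real {1} → Integrable (fun k : ℕ => |(k : ℝ) - m| ^ 3) ν →
      ∫ k : ℕ, ((k : ℝ) - m) ∂ν = 0 → ∫ k : ℕ, |(k : ℝ) - m| ^ 3 ∂ν ≤ M →
      ∀ N n : ℕ, N₀ ≤ N → N * m = n →
        c / √N ≤ (Measure.pi fun _ : Fin N => ν).real {x | ∑ j, x j = n} := by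
  have hpi := Real.pi_pos
  set E := Real.exp (-((1 + M) / 2)) with hE
  have hE0 : 0 < E := Real.exp_pos _
  set C := |4 * M + (1 + M) ^ 2 * Real.pi / 4| with hC
  set c := r / Real.pi ^ 2 with hc
  have hc0 : 0 < c := by positivity
  -- The main term is `E / √N` and the error is `O(1 / N)`; past this threshold the error is at most
  -- half the main term. The `+ 2` makes `L = N - 1` positive.
  refine ⟨E / 2 / Real.pi, by positivity, ⌈(4 * C / (c ^ 2 * E)) ^ 2⌉₊ + 2, ?_⟩
  intro ν _ m h0 h1 h hm hM N n hN hNm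
  obtain ⟨L, rfl⟩ : ∃ L, N = L + 1 := ⟨N - 1, by omega⟩
  have hL : 0 < L := by omega
  have hL' : (1 : ℝ) ≤ L := by exact_mod_cast hL
  have key := le_pi_mul_measureReal_sum_eq hr h0 h1 h hm hM hL hNm
  have hNr : (4 * C / (c ^ 2 * E)) ^ 2 ≤ (L : ℝ) + 1 := by
    refine (Nat.le_ceil _).trans ?_
    exact_mod_cast (show ⌈(4 * C / (c ^ 2 * E)) ^ 2⌉₊ ≤ L + 1 by omega)
  have hs : 0 < √((L : ℝ) + 1) := by positivity
  have hsq : √((L : ℝ) + 1) ^ 2 = (L : ℝ) + 1 := Real.sq_sqrt (by positivity)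
  have hsl : 4 * C / (c ^ 2 * E) ≤ √((L : ℝ) + 1) := Real.le_sqrt_of_sq_le hNr
  rw [div_le_iff₀ (by positivity)] at hsl
  have hsmall : ((L : ℝ) + 1) * ((4 * M + (1 + M) ^ 2 * Real.pi / 4) / (2 * (c * L) ^ 2)) ≤
      E / 2 / √((L : ℝ) + 1) := by
    calc _ ≤ ((L : ℝ) + 1) * (C / (2 * (c * ((L + 1) / 2)) ^ 2)) := by
          gcongr
          · exact le_abs_self _
          · linarith
      _ = 2 * C / (c ^ 2 * ((L : ℝ) + 1)) := by field_simp
      _ ≤ _ := by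
          rw [← hsq, div_le_div_iff₀ (by positivity) (by positivity), Real.sqrt_sq hs.le]
          nlinarith
  push_cast
  have : E / √((L : ℝ) + 1) = E / 2 / √((L : ℝ) + 1) + E / 2 / √((L : ℝ) + 1) := by ring
  have e : E / 2 / Real.pi / √((L : ℝ) + 1) = E / 2 / √((L : ℝ) + 1) / Real.pi := by ring
  rw [e, div_le_iff₀ hpi]
  linarith

end LocalLimit

/-! ### Change of parameter, and comparison of the scheme with independent boxes. -/

section Domination

lemma weight_change {b : ℕ → ℝ} (hb : ∀ k, 0 ≤ b k) (hb0 : 0 < b 0) {θ ϑ : ℝ}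
    (hθ : θ ∈ params b) (hϑ : ϑ ∈ params b) (k : ℕ) :
    weight b ϑ k = B b θ / B b ϑ * (ϑ / θ) ^ k * weight b θ k := by
  have h0 := hθ.1
  have h1 := B_pos hb hb0 hθ
  have h2 := B_pos hb hb0 hϑ
  rw [weight_eq, weight_eq, div_pow]
  field_simp

/-- Conditionally on the sum, the law of independent copies of `ξ(θ)` does not depend on `θ`. -/
lemma exists_restrict_pi_law_eq {b : ℕ → ℝ} (hb : ∀ k, 0 ≤ b k) (hb0 : 0 < b 0) {θ ϑ : ℝ}
    (hθ : θ ∈ params b) (hϑ : ϑ ∈ params b) (N n : ℕ) :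
    ∃ c : ENNReal, c ≠ 0 ∧ c ≠ ⊤ ∧
      (Measure.pi fun _ : Fin N => law b ϑ).restrict {x | ∑ j, x j = n} =
        c • (Measure.pi fun _ : Fin N => law b θ).restrict {x | ∑ j, x j = n} := by
  have := isProbabilityMeasure_law hb hb0 hθ
  have := isProbabilityMeasure_law hb hb0 hϑ
  have h1 := B_pos hb hb0 hθ
  have h2 := B_pos hb hb0 hϑ
  have h3 := hθ.1
  have h4 := hϑ.1
  -- The density between the two product laws depends on `x` only through the sum of its entries,
  -- hence is constant on the event.
  refine ⟨ENNReal.ofReal ((B b θ / B b ϑ) ^ N * (ϑ / θ) ^ n), ?_, ENNReal.ofReal_ne_top, ?_⟩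
  · rw [Ne, ENNReal.ofReal_eq_zero, not_le]
    positivity
  · refine Measure.ext_of_singleton fun x => ?_
    rw [Measure.smul_apply, Measure.restrict_apply (measurableSet_singleton x),
      Measure.restrict_apply (measurableSet_singleton x)]
    by_cases hx : x ∈ {x : Fin N → ℕ | ∑ j, x j = n}
    · rw [Set.inter_eq_left.2 (Set.singleton_subset_iff.2 hx), Measure.pi_singleton,
        Measure.pi_singleton, smul_eq_mul]
      simp only [law_singleton]
      rw [← ENNReal.ofReal_prod_of_nonneg fun j _ => weight_nonneg hb hb0 hϑ _,
        ← ENNReal.ofReal_prod_of_nonneg fun j _ => weight_nonneg hb hb0 hθ _,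
        ← ENNReal.ofReal_mul (by positivity)]
      congr 1
      have hx' : ∑ j, x j = n := hx
      rw [← hx', ← Finset.prod_pow_eq_pow_sum]
      simp only [weight_change hb hb0 hθ hϑ, Finset.prod_mul_distrib, Finset.prod_const,
        Finset.card_univ, Fintype.card_fin]
    · rw [Set.singleton_inter_eq_empty.2 hx]
      simp

lemma cond_eq_of_restrict_eq {α : Type*} [MeasurableSpace α] {μ ν : Measure α} {s : Set α}
    {c : ENNReal} (hc0 : c ≠ 0) (hc : c ≠ ⊤) (h : μ.restrict s = c • ν.restrict s) :
    cond μ s = cond ν s := by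
  have hs : μ s = c * ν s := by
    have := congrArg (fun m : Measure α => m Set.univ) h
    simpa using this
  rw [ProbabilityTheory.cond, ProbabilityTheory.cond, h, hs, smul_smul,
    ENNReal.mul_inv (Or.inl hc0) (Or.inl hc), mul_right_comm,
    ENNReal.inv_mul_cancel hc0 hc, one_mul]

/-- Allows the given parameters to be replaced by those that put the conditioning event at the mean
of the sum. -/
lemma IsScheme.change_params {Ω : Type*} [MeasurableSpace Ω] {P : Measure Ω} {K N : ℕ}
    {b : Fin K → ℕ → ℝ} (hb : ∀ i k, 0 ≤ b i k) (hb0 : ∀ i, 0 < b i 0) {θ ϑ : Fin K → ℝ}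
    (hθ : ∀ i, θ i ∈ params (b i)) (hϑ : ∀ i, ϑ i ∈ params (b i)) {n : Fin K → ℕ}
    {η : Fin N → Ω → (Fin K → ℕ)} (h : IsScheme P n (fun i _ => law (b i) (ϑ i)) η) :
    IsScheme P n (fun i _ => law (b i) (θ i)) η := by
  refine ⟨h.measurable, fun i h0 => h.pos i ?_, fun k hk => ?_⟩
  · obtain ⟨c, hc0, hc, hr⟩ := exists_restrict_pi_law_eq (hb i) (hb0 i) (hθ i) (hϑ i) N (n i)
    have := congrArg (fun m : Measure (Fin N → ℕ) => m Set.univ) hr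
    simpa [h0] using this
  · rw [h.prob_eq k hk]
    refine Finset.prod_congr rfl fun i _ => ?_
    obtain ⟨c, hc0, hc, hr⟩ := exists_restrict_pi_law_eq (hb i) (hb0 i) (hθ i) (hϑ i) N (n i)
    rw [cond_eq_of_restrict_eq hc0 hc hr]

lemma IsScheme.measurable_joint {Ω : Type*} [MeasurableSpace Ω] {P : Measure Ω} {K N : ℕ}
    {n : Fin K → ℕ} {ν : Fin K → Fin N → Measure ℕ} {η : Fin N → Ω → (Fin K → ℕ)}
    (h : IsScheme P n ν η) : Measurable fun ω j => η j ω :=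
  measurable_pi_lambda _ h.measurable

lemma setOf_forall_apply_eq {ι α : Type*} (k : ι → α) : {x : ι → α | ∀ j, x j = k j} = {k} := by
  ext x
  simp [funext_iff]

lemma IsScheme.map_singleton {Ω : Type*} [MeasurableSpace Ω] {P : Measure Ω} {K N : ℕ}
    {n : Fin K → ℕ} {ν : Fin K → Fin N → Measure ℕ} {η : Fin N → Ω → (Fin K → ℕ)}
    (h : IsScheme P n ν η) {k : Fin N → Fin K → ℕ}
    (hk : ∀ i, ∑ j, k j i = n i) :
    P.map (fun ω j => η j ω) {k} =
      ∏ i, cond (Measure.pi (ν i)) {x | ∑ j, x j = n i} {fun j => k j i} := by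
  rw [Measure.map_apply h.measurable_joint (measurableSet_singleton k)]
  have h1 : (fun ω j => η j ω) ⁻¹' {k} = {ω | ∀ j, η j ω = k j} := by
    ext ω
    simp [funext_iff]
  rw [h1, h.prob_eq k hk]
  simp only [setOf_forall_apply_eq]

variable {Ω : Type*} [MeasurableSpace Ω] {P : Measure Ω} {K N : ℕ}
  {n : Fin K → ℕ} {ν : Fin K → Fin N → Measure ℕ} [∀ i j, IsProbabilityMeasure (ν i j)]
  {η : Fin N → Ω → (Fin K → ℕ)}

/-- The numbers of balls of each colour are almost surely the prescribed ones. -/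
lemma IsScheme.map_sums_eq (h : IsScheme P n ν η) :
    P.map (fun ω j => η j ω) {k | ∀ i, ∑ j, k j i = n i} = 1 := by
  set V : Set (Fin N → Fin K → ℕ) := {k | ∀ i, ∑ j, k j i = n i} with hV
  have hc : ∀ i, IsProbabilityMeasure (cond (Measure.pi (ν i)) {x | ∑ j, x j = n i}) :=
    fun i => cond_isProbabilityMeasure (h.pos i)
  -- `prob_eq` prescribes masses only on `V`. There they agree with the transposed product of the
  -- conditional laws, which is concentrated on `V`; so `V` already has full mass.
  set Q := Measure.pi fun i => cond (Measure.pi (ν i)) {x | ∑ j, x j = n i} with hQ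
  set τ := Q.map fun x j i => x i j with hτ
  have hsw : Measurable fun (x : Fin K → Fin N → ℕ) (j : Fin N) (i : Fin K) => x i j :=
    Measurable.of_discrete
  have h1 : (P.map fun ω j => η j ω).restrict V = τ.restrict V := by
    refine Measure.ext_of_singleton fun k => ?_
    rw [Measure.restrict_apply (measurableSet_singleton k),
      Measure.restrict_apply (measurableSet_singleton k)]
    by_cases hk : k ∈ V
    · rw [Set.inter_eq_left.2 (Set.singleton_subset_iff.2 hk), h.map_singleton hk, hτ,
        Measure.map_apply hsw (measurableSet_singleton k)]
      have h2 : (fun (x : Fin K → Fin N → ℕ) (j : Fin N) (i : Fin K) => x i j) ⁻¹' {k} =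
          {fun i j => k j i} := by
        ext x
        simp only [Set.mem_preimage, Set.mem_singleton_iff, funext_iff]
        exact forall_comm
      rw [h2, hQ, Measure.pi_singleton]
    · rw [Set.singleton_inter_eq_empty.2 hk]
      simp
  have h3 := congrArg (fun m : Measure (Fin N → Fin K → ℕ) => m Set.univ) h1
  simp only [Measure.restrict_apply_univ] at h3
  rw [h3, hτ, Measure.map_apply hsw MeasurableSet.of_discrete]
  have h4 : (fun (x : Fin K → Fin N → ℕ) (j : Fin N) (i : Fin K) => x i j) ⁻¹' V =
      Set.univ.pi fun i => {x : Fin N → ℕ | ∑ j, x j = n i} := by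
    ext x
    simp [hV]
  rw [h4, hQ, Measure.pi_pi]
  refine Finset.prod_eq_one fun i _ => ?_
  exact cond_apply_self (h.pos i) (measure_ne_top _ _)

/-- For configurations with the right totals this is an equality, conditioning being division by the
probability of the condition; all others are null by `IsScheme.map_sums_eq`. -/
lemma IsScheme.map_singleton_le [IsProbabilityMeasure P] (h : IsScheme P n ν η)
    (k : Fin N → Fin K → ℕ) :
    P.map (fun ω j => η j ω) {k} ≤
      (∏ i, (Measure.pi (ν i) {x | ∑ j, x j = n i})⁻¹) *
        Measure.pi (fun j => Measure.pi fun i => ν i j) {k} := by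
  have := Measure.isProbabilityMeasure_map (μ := P) h.measurable_joint.aemeasurable
  by_cases hk : ∀ i, ∑ j, k j i = n i
  · rw [h.map_singleton hk, Measure.pi_singleton]
    simp only [Measure.pi_singleton]
    rw [Finset.prod_comm, ← Finset.prod_mul_distrib]
    refine le_of_eq (Finset.prod_congr rfl fun i _ => ?_)
    rw [cond_apply MeasurableSet.of_discrete, Set.inter_eq_right.2, Measure.pi_singleton]
    exact Set.singleton_subset_iff.2 (hk i)
  · have h0 : P.map (fun ω j => η j ω) {k | ∀ i, ∑ j, k j i = n i}ᶜ = 0 := by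
      rw [prob_compl_eq_zero_iff MeasurableSet.of_discrete]
      exact h.map_sums_eq
    rw [measure_mono_null (Set.singleton_subset_iff.2 hk) h0]
    exact bot_le

/-- The probabilities in the allocation scheme exceed those for independent boxes at most by the
reciprocal of the probability of the condition. -/
theorem IsScheme.measure_le [IsProbabilityMeasure P] (h : IsScheme P n ν η)
    (A : Set (Fin N → Fin K → ℕ)) :
    P {ω | (fun j => η j ω) ∈ A} ≤
      (∏ i, (Measure.pi (ν i) {x | ∑ j, x j = n i})⁻¹) *
        Measure.pi (fun j => Measure.pi fun i => ν i j) A := by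
  have h1 : P {ω | (fun j => η j ω) ∈ A} = P.map (fun ω j => η j ω) A := by
    rw [Measure.map_apply h.measurable_joint MeasurableSet.of_discrete]
    rfl
  rw [h1, ← Measure.tsum_indicator_apply_singleton _ A MeasurableSet.of_discrete,
    ← Measure.tsum_indicator_apply_singleton (Measure.pi _) A MeasurableSet.of_discrete,
    ← ENNReal.tsum_mul_left]
  refine ENNReal.tsum_le_tsum fun k => ?_
  by_cases hk : k ∈ A
  · simp only [Set.indicator_of_mem hk]
    exact h.map_singleton_le k
  · simp [Set.indicator_of_notMem hk]

end Domination

/-! ### Exponential bounds for independent boxes. -/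

section Chernoff

/-- The cubic remainder is at most `(2 / 9) |y| ^ 3 ≤ y ^ 2 / 6` here, and `1 / 2 + 1 / 6 = 2 / 3`.
-/
lemma exp_le_quadratic {y : ℝ} (hy : |y| ≤ 3 / 4) : Real.exp y ≤ 1 + y + 2 / 3 * y ^ 2 := by
  have h := Real.exp_bound (x := y) (by linarith) (n := 3) (by norm_num)
  have h1 : ∑ m ∈ Finset.range 3, y ^ m / (m.factorial : ℝ) = 1 + y + y ^ 2 / 2 := by
    simp [Finset.sum_range_succ, Nat.factorial]
  rw [h1] at h
  have h2 := (abs_le.1 h).2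
  have h3 : |y| ^ 3 ≤ 3 / 4 * y ^ 2 := by
    rw [pow_succ, sq_abs]
    nlinarith [sq_nonneg y]
  norm_num [Nat.factorial] at h2
  linarith

variable {E : Type*} [MeasurableSpace E]

lemma integral_exp_mul_le {κ : Measure E} [IsProbabilityMeasure κ] {f : E → ℝ}
    (hf : Measurable f) (hf1 : ∀ v, |f v| ≤ 1) (hf0 : ∫ v, f v ∂κ = 0) {a : ℝ} (ha0 : 0 ≤ a)
    (ha : a ≤ 3 / 4) :
    ∫ v, Real.exp (a * f v) ∂κ ≤ Real.exp (2 / 3 * a ^ 2 * ∫ v, f v ^ 2 ∂κ) := by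
  have i1 : Integrable f κ := Integrable.of_bound hf.aestronglyMeasurable 1 (ae_of_all _ hf1)
  have i2 : Integrable (fun v => f v ^ 2) κ := by
    refine Integrable.of_bound (hf.pow_const 2).aestronglyMeasurable 1 (ae_of_all _ fun v => ?_)
    rw [norm_pow, Real.norm_eq_abs]
    exact pow_le_one₀ (abs_nonneg _) (hf1 v)
  have hbd : ∀ v, |a * f v| ≤ 3 / 4 := fun v => by
    rw [abs_mul, abs_of_nonneg ha0]
    calc a * |f v| ≤ 3 / 4 * 1 := by gcongr; exact hf1 v
      _ = _ := mul_one _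
  have i3 : Integrable (fun v => Real.exp (a * f v)) κ := by
    refine Integrable.of_bound (hf.const_mul a).exp.aestronglyMeasurable (Real.exp (3 / 4))
      (ae_of_all _ fun v => ?_)
    rw [Real.norm_of_nonneg (Real.exp_pos _).le, Real.exp_le_exp]
    exact (le_abs_self _).trans (hbd v)
  have i4 : Integrable (fun v => 1 + a * f v) κ := (integrable_const _).add (i1.const_mul a)
  calc _ ≤ ∫ v, (1 + a * f v + 2 / 3 * a ^ 2 * f v ^ 2) ∂κ := by
        refine integral_mono i3 (i4.add (i2.const_mul _)) fun v => ?_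
        refine (exp_le_quadratic (hbd v)).trans_eq ?_
        ring
    _ = 2 / 3 * a ^ 2 * (∫ v, f v ^ 2 ∂κ) + 1 := by
        rw [integral_add i4 (i2.const_mul _), integral_add (integrable_const _) (i1.const_mul a),
          integral_const_mul, integral_const_mul, hf0]
        simp
        ring
    _ ≤ _ := Real.add_one_le_exp _

/-- A Bernstein type inequality in the range of moderate deviations. -/
lemma measureReal_le_sum_le {κ : Measure E} [IsProbabilityMeasure κ] {f : E → ℝ}
    (hf : Measurable f) (hf1 : ∀ v, |f v| ≤ 1) (hf0 : ∫ v, f v ∂κ = 0) {v x : ℝ}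
    (hv : ∫ w, f w ^ 2 ∂κ = v) (hv0 : 0 < v) {N : ℕ} (hN : 0 < N) (hx0 : 0 ≤ x) (hx : x ≤ v * N) :
    (Measure.pi fun _ : Fin N => κ).real {y | x ≤ ∑ j, f (y j)} ≤
      Real.exp (-(3 * x ^ 2 / (8 * (v * N)))) := by
  have hN' : (0 : ℝ) < N := by exact_mod_cast hN
  set μ := Measure.pi fun _ : Fin N => κ with hμ
  -- The minimiser of `-a x + (2 / 3) a² v N`, with minimum `-3 x² / (8 v N)`; the condition `x ≤ v
  -- N` is exactly `a ≤ 3 / 4`.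
  set a := 3 * x / (4 * (v * N)) with ha
  have ha0 : 0 ≤ a := by positivity
  have ha1 : a ≤ 3 / 4 := by
    rw [ha, div_le_div_iff₀ (by positivity) (by norm_num)]
    linarith
  have hm : Measurable fun y : Fin N → E => ∑ j, f (y j) :=
    Finset.measurable_sum _ fun j _ => hf.comp (measurable_pi_apply j)
  have hb : ∀ y : Fin N → E, |∑ j, f (y j)| ≤ N := fun y => by
    refine (Finset.abs_sum_le_sum_abs _ _).trans ?_
    refine (Finset.sum_le_sum fun j _ => hf1 (y j)).trans_eq ?_
    simp
  have hi : Integrable (fun y => Real.exp (a * ∑ j, f (y j))) μ := by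
    refine Integrable.of_bound (hm.const_mul a).exp.aestronglyMeasurable (Real.exp (a * N))
      (ae_of_all _ fun y => ?_)
    rw [Real.norm_of_nonneg (Real.exp_pos _).le, Real.exp_le_exp]
    gcongr
    exact (le_abs_self _).trans (hb y)
  have h1 := measure_ge_le_exp_mul_mgf (μ := μ) (X := fun y => ∑ j, f (y j)) x ha0 hi
  refine h1.trans ?_
  have h2 : mgf (fun y => ∑ j, f (y j)) μ a = (∫ v, Real.exp (a * f v) ∂κ) ^ N := by
    have h3 := integral_fintype_prod_eq_pow (ι := Fin N) (μ := κ) (𝕜 := ℝ)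
      (fun v => Real.exp (a * f v))
    rw [Fintype.card_fin] at h3
    rw [← h3, mgf]
    refine integral_congr_ae (ae_of_all _ fun y => ?_)
    simp only [Finset.mul_sum, Real.exp_sum]
  rw [h2]
  have h4 := integral_exp_mul_le hf hf1 hf0 ha0 ha1
  rw [hv] at h4
  calc _ ≤ Real.exp (-a * x) * Real.exp (2 / 3 * a ^ 2 * v) ^ N := by
        gcongr
    _ = _ := by
        rw [← Real.exp_nat_mul, ← Real.exp_add, ha]
        congr 1
        field_simp
        ring

theorem measureReal_le_abs_sum_le {κ : Measure E} [IsProbabilityMeasure κ] {f : E → ℝ}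
    (hf : Measurable f) (hf1 : ∀ v, |f v| ≤ 1) (hf0 : ∫ v, f v ∂κ = 0) {v x : ℝ}
    (hv : ∫ w, f w ^ 2 ∂κ = v) (hv0 : 0 < v) {N : ℕ} (hN : 0 < N) (hx0 : 0 ≤ x) (hx : x ≤ v * N) :
    (Measure.pi fun _ : Fin N => κ).real {y | x ≤ |∑ j, f (y j)|} ≤
      2 * Real.exp (-(3 * x ^ 2 / (8 * (v * N)))) := by
  have h1 := measureReal_le_sum_le hf hf1 hf0 hv hv0 hN hx0 hx
  have h2 := measureReal_le_sum_le (f := fun v => -f v) hf.neg (by simpa using hf1)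
    (by rw [integral_neg, hf0, neg_zero]) (by simpa using hv) hv0 hN hx0 hx
  have h3 : {y : Fin N → E | x ≤ |∑ j, f (y j)|} =
      {y | x ≤ ∑ j, f (y j)} ∪ {y | x ≤ ∑ j, -f (y j)} := by
    ext y
    simp [le_abs]
  rw [h3, two_mul]
  exact (measureReal_union_le _ _).trans (add_le_add h1 h2)

end Chernoff

/-! ### Bounds for one colour, uniform in the ratio of balls to boxes. -/

section Uniformity

variable {b : ℕ → ℝ}

lemma integrable_cube_law (hb : ∀ k, 0 ≤ b k) (hb0 : 0 < b 0) {θ : ℝ} (hθ : θ ∈ params b) {m : ℝ}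
    (hm : 0 ≤ m) :
    Integrable (fun k : ℕ => |(k : ℝ) - m| ^ 3) (law b θ) ∧
      ∫ k : ℕ, |(k : ℝ) - m| ^ 3 ∂(law b θ) ≤
        4 * ∑' k : ℕ, (k : ℝ) ^ 3 * weight b θ k + 4 * m ^ 3 := by
  have hle : ∀ k : ℕ, weight b θ k * |(k : ℝ) - m| ^ 3 ≤
      4 * ((k : ℝ) ^ 3 * weight b θ k) + 4 * m ^ 3 * weight b θ k := fun k => by
    have hk : (0 : ℝ) ≤ k := Nat.cast_nonneg k
    have h1 : |(k : ℝ) - m| ≤ k + m := by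
      rw [abs_le]
      constructor <;> linarith
    have h2 : |(k : ℝ) - m| ^ 3 ≤ 4 * (k : ℝ) ^ 3 + 4 * m ^ 3 := by
      refine (pow_le_pow_left₀ (abs_nonneg _) h1 3).trans ?_
      nlinarith [mul_nonneg (add_nonneg hk hm) (sq_nonneg ((k : ℝ) - m))]
    nlinarith [mul_le_mul_of_nonneg_left h2 (weight_nonneg hb hb0 hθ k)]
  have s1 := (summable_pow_mul_weight hb hθ 3).mul_left 4
  have s2 := (summable_weight hb hθ).mul_left (4 * m ^ 3)
  have s3 : Summable fun k : ℕ => weight b θ k * |(k : ℝ) - m| ^ 3 :=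
    Summable.of_nonneg_of_le
      (fun k => mul_nonneg (weight_nonneg hb hb0 hθ k) (by positivity)) hle (s1.add s2)
  refine ⟨integrable_law hb hb0 hθ ?_, ?_⟩
  · simpa using s3
  · rw [integral_law hb hb0 hθ]
    refine (Summable.tsum_le_tsum hle s3 (s1.add s2)).trans_eq ?_
    rw [s1.tsum_add s2, tsum_mul_left, tsum_mul_left, tsum_weight hb hb0 hθ, mul_one]

lemma integral_sub_law (hb : ∀ k, 0 ≤ b k) (hb0 : 0 < b 0) {θ : ℝ} (hθ : θ ∈ params b) :
    ∫ k : ℕ, ((k : ℝ) - mean b θ) ∂(law b θ) = 0 := by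
  rw [integral_law hb hb0 hθ]
  simp only [mul_comm (weight b θ _)]
  rw [tsum_sub_mul_weight hb hb0 hθ, sub_self]

lemma law_real_singleton (hb : ∀ k, 0 ≤ b k) (hb0 : 0 < b 0) {θ : ℝ} (hθ : θ ∈ params b) (k : ℕ) :
    (law b θ).real {k} = weight b θ k := by
  rw [measureReal_def, law_singleton, ENNReal.toReal_ofReal (weight_nonneg hb hb0 hθ k)]

/-- The estimates for one colour, uniform over the admissible ratios `α`. -/
lemma exists_uniform_bounds (hb : ∀ k, 0 ≤ b k) (hb0 : 0 < b 0) (hb1 : 0 < b 1) {θ'' α' : ℝ}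
    (hθ'' : θ'' ∈ params b) (hα' : 0 < α') {s : ℕ} (hs : 0 < b s) :
    ∃ δ c : ℝ, 0 < δ ∧ 0 < c ∧ ∃ N₀ : ℕ, ∀ α, α' < α → α < mean b θ'' →
      meanInv b α ∈ params b ∧ δ ≤ weight b (meanInv b α) s ∧
        weight b (meanInv b α) s ≤ 1 - δ ∧
        ∀ N n : ℕ, N₀ ≤ N → N * α = n → c / √N ≤
          (Measure.pi fun _ : Fin N => law b (meanInv b α)).real {x | ∑ j, x j = n} := by
  obtain ⟨θ', h0, hinv⟩ := exists_meanInv_bounds hb hb0 hθ'' hα'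
  obtain ⟨δ₀, hδ₀, hw0⟩ := exists_le_weight hb hb0 hθ'' h0 hb0
  obtain ⟨δ₁, hδ₁, hw1⟩ := exists_le_weight hb hb0 hθ'' h0 hb1
  obtain ⟨δ₂, hδ₂, hw2⟩ := exists_le_weight hb hb0 hθ'' h0 hs
  obtain ⟨M, hM⟩ := exists_moment_le hb hb0 hθ'' 3
  obtain ⟨c, hc, N₀, hllt⟩ := exists_le_measureReal_sum_eq (r := min δ₀ δ₁) (by positivity)
    (4 * M + 4 * mean b θ'' ^ 3)
  refine ⟨min (min δ₀ δ₁) δ₂, c, by positivity, hc, N₀, fun α h1 h2 => ?_⟩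
  obtain ⟨hlow, hup, hmean⟩ := hinv α h1 h2
  set θ := meanInv b α
  have hθ : θ ∈ params b := mem_params_of_le hθ'' (h0.trans_le hlow) hup
  have hα0 : 0 < α := hα'.trans h1
  refine ⟨hθ, (min_le_right _ _).trans (hw2 θ hlow hup), ?_, fun N n hN hNα => ?_⟩
  -- The weight at `s` stays away from `1` because another value keeps a fixed mass: `1` when `s =
  -- 0`, and `0` otherwise.
  · rcases eq_or_ne s 0 with rfl | hs0
    · have h3 := weight_add_weight_le_one hb hb0 hθ (zero_ne_one' ℕ)
      have h4 := hw1 θ hlow hup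
      have h5 := (min_le_left (min δ₀ δ₁) δ₂).trans (min_le_right δ₀ δ₁)
      linarith
    · have h3 := weight_add_weight_le_one hb hb0 hθ hs0
      have h4 := hw0 θ hlow hup
      have h5 := (min_le_left (min δ₀ δ₁) δ₂).trans (min_le_left δ₀ δ₁)
      linarith
  · have := isProbabilityMeasure_law hb hb0 hθ
    obtain ⟨hi, hle⟩ := integrable_cube_law hb hb0 hθ hα0.le
    refine hllt (law b θ) α ?_ ?_ hi ?_ ?_ N n hN hNα
    · rw [law_real_singleton hb hb0 hθ]
      exact (min_le_left _ _).trans (hw0 θ hlow hup)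
    · rw [law_real_singleton hb hb0 hθ]
      exact (min_le_right _ _).trans (hw1 θ hlow hup)
    · rw [← hmean]
      exact integral_sub_law hb hb0 hθ
    · refine hle.trans ?_
      have := hM θ hθ.1 hup
      gcongr

end Uniformity

/-! ### Tail bounds for the number of boxes with given contents. -/

section TailBound

lemma boxCount_bounds {Ω : Type*} {K N : ℕ} (η : Fin N → Ω → (Fin K → ℕ)) (s : Fin K → ℕ) (ω : Ω) :
    0 ≤ boxCount η s ω ∧ boxCount η s ω ≤ N := by
  refine ⟨Finset.sum_nonneg fun j _ => by split_ifs <;> norm_num, ?_⟩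
  refine (Finset.sum_le_sum (g := fun _ => (1 : ℝ)) fun j _ => by split_ifs <;> norm_num).trans_eq ?_
  simp

lemma measurable_boxCount {Ω : Type*} [MeasurableSpace Ω] {K N : ℕ} {η : Fin N → Ω → (Fin K → ℕ)}
    (hη : ∀ j, Measurable (η j)) (s : Fin K → ℕ) : Measurable (boxCount η s) := by
  refine Finset.measurable_sum _ fun j _ => ?_
  exact (Measurable.of_discrete (f := fun v : Fin K → ℕ => if v = s then (1 : ℝ) else 0)).comp (hη j)

variable {Ω : Type*} [MeasurableSpace Ω] {P : Measure Ω} [IsProbabilityMeasure P] {K N : ℕ}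
  {n : Fin K → ℕ} {η : Fin N → Ω → (Fin K → ℕ)}

/-- The tail bound for the number of boxes with contents `s`, in terms of lower bounds `c i / √N`
for the probabilities of the conditions. -/
lemma IsScheme.measureReal_le_abs_boxCount_sub_le {κ : Fin K → Measure ℕ}
    [∀ i, IsProbabilityMeasure (κ i)] (h : IsScheme P n (fun i _ => κ i) η) (hN : 0 < N)
    {c : Fin K → ℝ} (hc : ∀ i, 0 < c i)
    (hcn : ∀ i, c i / √N ≤ (Measure.pi fun _ : Fin N => κ i).real {x | ∑ j, x j = n i})
    (s : Fin K → ℕ) {p x : ℝ} (hp : ∏ i, (κ i).real {s i} = p) (hp0 : 0 < p * (1 - p))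
    (hx0 : 0 ≤ x) (hx : x ≤ p * (1 - p) * N) :
    P.real {ω | x ≤ |boxCount η s ω - N * p|} ≤
      (∏ i, (c i)⁻¹) * √N ^ K * (2 * Real.exp (-(3 * x ^ 2 / (8 * (p * (1 - p) * N))))) := by
  have hN' : (0 : ℝ) < N := by exact_mod_cast hN
  set ρ := Measure.pi κ with hR
  -- The centred indicator of `s`: its sum over the boxes is the count minus `N * p`, and its
  -- variance is `p * (1 - p)`.
  set f : (Fin K → ℕ) → ℝ := fun v => (if v = s then 1 else 0) - p with hf
  have hRs : ρ.real {s} = p := by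
    rw [← hp, measureReal_def, hR, Measure.pi_singleton, ENNReal.toReal_prod]
    rfl
  have hp1 : 0 < p ∧ p < 1 := by
    have h1 : 0 ≤ p := by rw [← hRs]; exact measureReal_nonneg
    have h2 : 0 < p := lt_of_le_of_ne h1 (by rintro rfl; simp at hp0)
    exact ⟨h2, by nlinarith⟩
  have hfm : Measurable f := Measurable.of_discrete
  have hf1 : ∀ v, |f v| ≤ 1 := fun v => by
    rw [hf, abs_le]
    simp only
    split_ifs <;> constructor <;> linarith
  have hind : (fun v => if v = s then (1 : ℝ) else 0) = Set.indicator {s} fun _ => (1 : ℝ) := by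
    ext v
    simp [Set.indicator_apply]
  have hii : Integrable (fun v => if v = s then (1 : ℝ) else 0) ρ := by
    rw [hind]
    exact (integrable_const _).indicator (measurableSet_singleton s)
  have hint : ∫ v, (if v = s then (1 : ℝ) else 0) ∂ρ = p := by
    rw [hind, integral_indicator_const _ (measurableSet_singleton s), hRs]
    simp
  have hf0 : ∫ v, f v ∂ρ = 0 := by
    rw [hf, integral_sub hii (integrable_const _), hint]
    simp
  have hf2 : ∫ v, f v ^ 2 ∂ρ = p * (1 - p) := by
    have h1 : ∀ v, f v ^ 2 = (1 - 2 * p) * (if v = s then (1 : ℝ) else 0) + p ^ 2 := fun v => by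
      simp only [hf]
      split_ifs <;> ring
    simp only [h1]
    rw [integral_add (hii.const_mul _) (integrable_const _), integral_const_mul, hint]
    simp
    ring
  have hcount : ∀ ω, boxCount η s ω - N * p = ∑ j, f (η j ω) := fun ω => by
    simp only [hf, boxCount]
    rw [Finset.sum_sub_distrib]
    simp
  have h1 := h.measure_le {y | x ≤ |∑ j, f (y j)|}
  have h2 := measureReal_le_abs_sum_le hfm hf1 hf0 hf2 hp0 hN hx0 hx
  simp only [hcount]
  have hQ : ∀ i, 0 < (Measure.pi fun _ : Fin N => κ i).real {x | ∑ j, x j = n i} := fun i =>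
    lt_of_lt_of_le (div_pos (hc i) (Real.sqrt_pos.2 hN')) (hcn i)
  have h3 : P.real {ω | x ≤ |∑ j, f (η j ω)|} ≤
      (∏ i, ((Measure.pi fun _ : Fin N => κ i).real {x | ∑ j, x j = n i})⁻¹) *
        (Measure.pi fun _ : Fin N => ρ).real {y | x ≤ |∑ j, f (y j)|} := by
    have h4 := ENNReal.toReal_mono ?_ h1
    · rw [ENNReal.toReal_mul, ENNReal.toReal_prod] at h4
      simp only [ENNReal.toReal_inv] at h4
      exact h4
    · refine ENNReal.mul_ne_top (ENNReal.prod_ne_top fun i _ => ?_) (measure_ne_top _ _)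
      exact ENNReal.inv_ne_top.2 (h.pos i)
  refine h3.trans (mul_le_mul ?_ h2 measureReal_nonneg ?_)
  · have h5 : (∏ i, (c i)⁻¹) * √N ^ K = ∏ i, (c i / √N)⁻¹ := by
      have h6 : ∀ i, (c i / √(N : ℝ))⁻¹ = (c i)⁻¹ * √N := fun i => by
        rw [inv_div, div_eq_inv_mul]
      simp only [h6, Finset.prod_mul_distrib, Finset.prod_const, Finset.card_univ,
        Fintype.card_fin]
    rw [h5]
    refine Finset.prod_le_prod (fun i _ => inv_nonneg.2 (hQ i).le) fun i _ => ?_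
    exact inv_anti₀ (div_pos (hc i) (Real.sqrt_pos.2 hN')) (hcn i)
  · have : 0 ≤ ∏ i, (c i)⁻¹ := Finset.prod_nonneg fun i _ => (inv_pos.2 (hc i)).le
    positivity

/-- The exponent of `N` on the left is `K / 2 - (3 / 2) (1 + K / 2) = -3 / 2 - K / 4`. -/
lemma sqrt_pow_mul_exp_le {N K : ℕ} (hN : 0 < N) {v x : ℝ} (hv : 0 < v)
    (hx : x = 2 * √(1 + (K : ℝ) / 2) * (√(N * Real.log N) * √v)) :
    √N ^ K * Real.exp (-(3 * x ^ 2 / (8 * (v * N)))) ≤ (N : ℝ) ^ (-(3 / 2) : ℝ) := by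
  have hN' : (1 : ℝ) ≤ N := by exact_mod_cast hN
  have hN0 : (0 : ℝ) < N := by linarith
  have hl : 0 ≤ Real.log N := Real.log_nonneg hN'
  have hx2 : x ^ 2 = 4 * (1 + (K : ℝ) / 2) * (N * Real.log N * v) := by
    rw [hx, mul_pow, mul_pow, mul_pow, Real.sq_sqrt (by positivity), Real.sq_sqrt (by positivity),
      Real.sq_sqrt hv.le]
    ring
  have h1 : √(N : ℝ) ^ K = Real.exp (Real.log N * ((K : ℝ) / 2)) := by
    rw [← Real.rpow_def_of_pos hN0, Real.sqrt_eq_rpow, ← Real.rpow_natCast, ← Real.rpow_mul hN0.le]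
    congr 1
    ring
  rw [h1, ← Real.exp_add, Real.rpow_def_of_pos hN0, Real.exp_le_exp, hx2]
  have h2 : 3 * (4 * (1 + (K : ℝ) / 2) * (N * Real.log N * v)) / (8 * (v * N)) =
      3 / 2 * (1 + (K : ℝ) / 2) * Real.log N := by
    field_simp
    ring
  rw [h2]
  nlinarith [mul_nonneg hl (Nat.cast_nonneg (α := ℝ) K)]

end TailBound

/-! ### From tail bounds to the almost sure statement. -/

section AlmostSure

/-- Tail bounds of order `N ^ (-3 / 2)` for the deviations from `a t` give an almost sure bound for
the deviations from the expectation. -/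
theorem ae_limsup_le_of_tail {Ω : Type*} [MeasurableSpace Ω] {P : Measure Ω}
    [IsProbabilityMeasure P] {X : ℕ → Ω → ℝ} (hX : ∀ t, Measurable (X t)) {a : ℕ → ℝ} {N : ℕ → ℕ}
    (hN : StrictMono N) (hXa : ∀ t ω, |X t ω - a t| ≤ N t) {σ : ℕ → ℝ} {σ₀ c C : ℝ}
    (hσ₀ : 0 < σ₀) (hσ : ∀ t, σ₀ ≤ σ t) (hc : 0 ≤ c) (hC : 0 ≤ C)
    (htail : ∀ᶠ t in atTop, P.real {ω | c * (√(N t * Real.log (N t)) * σ t) ≤ |X t ω - a t|} ≤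
      C * (N t : ℝ) ^ (-(3 / 2) : ℝ)) :
    ∀ᵐ ω ∂P, limsup (fun t : ℕ =>
      ((|X t ω - ∫ ω', X t ω' ∂P| / (√(N t * Real.log (N t)) * σ t) : ℝ) : EReal)) atTop ≤
      ((2 * c : ℝ) : EReal) := by
  set L : ℕ → ℝ := fun t => √(N t * Real.log (N t)) * σ t with hL
  set A : ℕ → Set Ω := fun t => {ω | c * L t ≤ |X t ω - a t|} with hA
  have hL0 : ∀ t, 0 ≤ L t := fun t => mul_nonneg (Real.sqrt_nonneg _) (hσ₀.le.trans (hσ t))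
  have hAm : ∀ t, MeasurableSet (A t) := fun t =>
    measurableSet_le measurable_const ((hX t).sub_const _).abs
  -- Strict growth of `N` turns bounds in `N t` into bounds in `t`, which gives summability of the
  -- tails and divergence of the normalisation.
  have hNt : ∀ t, t ≤ N t := fun t => hN.le_apply
  have hLtop : Tendsto L atTop atTop := by
    have h1 : Tendsto (fun t : ℕ => √(t : ℝ) * σ₀) atTop atTop :=
      (Real.tendsto_sqrt_atTop.comp tendsto_natCast_atTop_atTop).atTop_mul_const hσ₀
    refine tendsto_atTop_mono' _ ?_ h1
    filter_upwards [eventually_ge_atTop 3] with t ht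
    have h2 : (t : ℝ) ≤ N t := by exact_mod_cast hNt t
    have h3 : (3 : ℝ) ≤ t := by exact_mod_cast ht
    have h4 : 1 ≤ Real.log (N t) := by
      rw [Real.le_log_iff_exp_le (by linarith)]
      linarith [Real.exp_one_lt_d9]
    refine mul_le_mul (Real.sqrt_le_sqrt ?_) (hσ t) hσ₀.le (Real.sqrt_nonneg _)
    nlinarith
  have hsum : Summable fun t => P.real (A t) := by
    have h1 : Summable fun t : ℕ => C * (t : ℝ) ^ (-(3 / 2) : ℝ) :=
      (Real.summable_nat_rpow.2 (by norm_num)).mul_left C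
    refine h1.of_norm_bounded_eventually_nat ?_
    filter_upwards [htail, eventually_ge_atTop 1] with t ht h2
    rw [Real.norm_of_nonneg measureReal_nonneg]
    refine ht.trans (mul_le_mul_of_nonneg_left ?_ hC)
    refine Real.rpow_le_rpow_of_nonpos ?_ ?_ (by norm_num)
    · exact_mod_cast h2
    · exact_mod_cast hNt t
  have hfin : ∑' t, P (A t) ≠ ⊤ := by
    have h1 := hsum.tsum_ofReal_ne_top
    have h2 : ∀ t, ENNReal.ofReal (P.real (A t)) = P (A t) := fun t => ofReal_measureReal
    simpa only [h2] using h1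
  -- Off `A t` the deviation is at most `c * L t`. On `A t` it is at most `N t`, which contributes
  -- no more than `C * N ^ (-1 / 2) ≤ C` to the expectation.
  have hmean : ∀ᶠ t in atTop, |(∫ ω', X t ω' ∂P) - a t| ≤ c * L t + C := by
    filter_upwards [htail, eventually_ge_atTop 1] with t ht h2
    have hN1 : (1 : ℝ) ≤ N t := by exact_mod_cast h2.trans (hNt t)
    have hi : Integrable (fun ω => X t ω - a t) P :=
      Integrable.of_bound ((hX t).sub_const _).aestronglyMeasurable (N t) (ae_of_all _ (hXa t))
    have hi2 : Integrable (X t) P := by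
      refine (hi.add (integrable_const (a t))).congr (ae_of_all _ fun ω => ?_)
      simp
    have h3 : (∫ ω', X t ω' ∂P) - a t = ∫ ω', (X t ω' - a t) ∂P := by
      rw [integral_sub hi2 (integrable_const _)]
      simp
    have hind : Integrable (Set.indicator (A t) fun _ => (N t : ℝ)) P :=
      (integrable_const _).indicator (hAm t)
    rw [h3]
    calc |∫ ω', (X t ω' - a t) ∂P| ≤ ∫ ω', |X t ω' - a t| ∂P := abs_integral_le_integral_abs
      _ ≤ ∫ ω', (c * L t + Set.indicator (A t) (fun _ => (N t : ℝ)) ω') ∂P := by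
          refine integral_mono hi.abs ((integrable_const _).add hind) fun ω => ?_
          have h5 := mul_nonneg hc (hL0 t)
          by_cases hω : ω ∈ A t
          · simp only [Set.indicator_of_mem hω]
            linarith [hXa t ω]
          · simp only [Set.indicator_of_notMem hω, add_zero]
            exact (not_le.1 hω).le
      _ = c * L t + P.real (A t) * N t := by
          rw [integral_add (integrable_const _) hind, integral_indicator_const _ (hAm t)]
          simp
      _ ≤ c * L t + C * (N t : ℝ) ^ (-(3 / 2) : ℝ) * N t := by gcongr
      _ ≤ c * L t + C := by
          have h6 : (N t : ℝ) ^ (-(3 / 2) : ℝ) * N t ≤ 1 := by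
            rw [← Real.rpow_add_one (by positivity)]
            exact Real.rpow_le_one_of_one_le_of_nonpos hN1 (by norm_num)
          nlinarith
  have hlim : Tendsto (fun t => ((2 * c + C / L t : ℝ) : EReal)) atTop
      (𝓝 ((2 * c : ℝ) : EReal)) := by
    refine (continuous_coe_real_ereal.tendsto _).comp ?_
    simpa using (hLtop.const_div_atTop C).const_add (2 * c)
  filter_upwards [ae_eventually_notMem hfin] with ω hω
  rw [← hlim.limsup_eq]
  refine limsup_le_limsup ?_
  filter_upwards [hω, hmean, hLtop.eventually_gt_atTop 0] with t h1 h2 h3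
  rw [EReal.coe_le_coe_iff, div_le_iff₀ h3, add_mul, div_mul_cancel₀ _ h3.ne']
  have h4 : |X t ω - a t| < c * L t := not_le.1 h1
  -- The random deviation from `a t` and that of the expectation each cost `c * L t`, whence `2 *
  -- c`; the remaining `C` vanishes after division by `L t`.
  have h5 : |X t ω - ∫ ω', X t ω' ∂P| ≤ |X t ω - a t| + |(∫ ω', X t ω' ∂P) - a t| := by
    rw [abs_sub_comm (∫ ω', X t ω' ∂P)]
    exact abs_sub_le _ _ _
  linarith

end AlmostSure

/-! ### The deviation of order `√(N log N)`, and the theorem itself. -/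

lemma eventually_mul_log_le (A : ℝ) {B : ℝ} (hB : 0 < B) :
    ∀ᶠ x : ℝ in atTop, A * Real.log x ≤ B * x := by
  have h := (Real.isLittleO_log_id_atTop.const_mul_left A).bound hB
  filter_upwards [h, eventually_ge_atTop 0] with x hx hx0
  rw [id, Real.norm_of_nonneg hx0] at hx
  exact (le_abs_self _).trans hx

/-- The tail bound of order `N ^ (-3 / 2)` at the deviation `2 √(1 + K / 2) √(N log N) σ`. -/
lemma IsScheme.measureReal_le_rpow {Ω : Type*} [MeasurableSpace Ω] {P : Measure Ω}
    [IsProbabilityMeasure P] {K N : ℕ} {n : Fin K → ℕ} {η : Fin N → Ω → (Fin K → ℕ)}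
    {κ : Fin K → Measure ℕ} [∀ i, IsProbabilityMeasure (κ i)]
    (h : IsScheme P n (fun i _ => κ i) η) (hN : 0 < N) {c : Fin K → ℝ} (hc : ∀ i, 0 < c i)
    (hcn : ∀ i, c i / √N ≤ (Measure.pi fun _ : Fin N => κ i).real {x | ∑ j, x j = n i})
    (s : Fin K → ℕ) {p : ℝ} (hp : ∏ i, (κ i).real {s i} = p) (hp0 : 0 < p * (1 - p))
    (hlog : 4 * (1 + (K : ℝ) / 2) * Real.log N ≤ p * (1 - p) * N) :
    P.real {ω | 2 * √(1 + (K : ℝ) / 2) * (√(N * Real.log N) * √(p * (1 - p))) ≤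
        |boxCount η s ω - N * p|} ≤
      2 * (∏ i, (c i)⁻¹) * (N : ℝ) ^ (-(3 / 2) : ℝ) := by
  set v := p * (1 - p) with hv
  set x := 2 * √(1 + (K : ℝ) / 2) * (√(N * Real.log N) * √v) with hx
  have hN1 : (1 : ℝ) ≤ N := by exact_mod_cast hN
  have hl : 0 ≤ Real.log N := Real.log_nonneg hN1
  -- The deviation lies in the range of the Bernstein bound: after squaring, this is `hlog`
  -- multiplied by `N * v`.
  have hx2 : x ≤ v * N := by
    refine abs_le_of_sq_le_sq' ?_ (by positivity) |>.2
    rw [hx, mul_pow, mul_pow, mul_pow, Real.sq_sqrt (by positivity), Real.sq_sqrt (by positivity),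
      Real.sq_sqrt hp0.le]
    have := mul_le_mul_of_nonneg_right hlog (show 0 ≤ N * v by positivity)
    nlinarith
  refine (h.measureReal_le_abs_boxCount_sub_le hN hc hcn s hp hp0 (by positivity) hx2).trans ?_
  have h1 := sqrt_pow_mul_exp_le (K := K) hN hp0 hx
  have h2 : 0 ≤ ∏ i, (c i)⁻¹ := Finset.prod_nonneg fun i _ => (inv_pos.2 (hc i)).le
  nlinarith [mul_le_mul_of_nonneg_left h1 h2]

end MultiColourAllocation

open MultiColourAllocation MeasureTheory Filter

theorem theorem1p1 {Ω : Type*} [MeasurableSpace Ω] (P : MeasureTheory.Measure Ω)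
    [MeasureTheory.IsProbabilityMeasure P]
    (K : ℕ) (hK : 1 ≤ K)
    -- the coefficients of the power series
    (b : Fin K → ℕ → ℝ) (hb : ∀ i k, 0 ≤ b i k) (hb0 : ∀ i, 0 < b i 0) (hb1 : ∀ i, 0 < b i 1)
    (hR : ∀ i, 0 < MultiColourAllocation.radius (b i))
    -- the bounds for the ratios; `m_i⁻¹(α''_i)` exists and is less than `R_i`
    (α' α'' : Fin K → ℝ) (hα' : ∀ i, 0 < α' i) (hα : ∀ i, α' i < α'' i)
    (hα'' : ∀ i, ∃ θ'' ∈ MultiColourAllocation.params (b i),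
      MultiColourAllocation.mean (b i) θ'' = α'' i)
    -- the numbers of boxes and of balls at time `t`
    (N : ℕ → ℕ) (hNpos : ∀ t, 0 < N t) (hN : StrictMono N) (n : ℕ → Fin K → ℕ)
    (hn : ∀ t i, α' i < (n t i : ℝ) / N t ∧ (n t i : ℝ) / N t < α'' i)
    -- the allocation at time `t`, arising from `ξ_i(ϑ t i)` for any admissible parameter `ϑ t i`
    (ϑ : ℕ → Fin K → ℝ) (hϑ : ∀ t i, ϑ t i ∈ MultiColourAllocation.params (b i))
    (η : ∀ t, Fin (N t) → Ω → (Fin K → ℕ))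
    (hη : ∀ t, MultiColourAllocation.IsScheme P (n t)
      (fun i _ => MultiColourAllocation.law (b i) (ϑ t i)) (η t))
    (s : Fin K → ℕ) (hs : ∀ i, 0 < b i (s i)) :
    ∀ᵐ ω ∂P, Filter.limsup (fun t : ℕ =>
      ((|MultiColourAllocation.boxCount (η t) s ω
          - ∫ ω', MultiColourAllocation.boxCount (η t) s ω' ∂P|
        / (Real.sqrt (N t * Real.log (N t)) *
            MultiColourAllocation.boxSigma b
              (fun i => MultiColourAllocation.meanInv (b i) ((n t i : ℝ) / N t)) s) : ℝ) : EReal))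
      Filter.atTop ≤ ((4 * Real.sqrt (1 + (K : ℝ) / 2) : ℝ) : EReal) := by
  choose θ'' hθ'' hmean using hα''
  choose δ c hδ hc N₀ hunif using fun i =>
    exists_uniform_bounds (hb i) (hb0 i) (hb1 i) (hθ'' i) (hα' i) (hs i)
  set θ : ℕ → Fin K → ℝ := fun t i => meanInv (b i) ((n t i : ℝ) / N t) with hθdef
  have hu := fun t i => hunif i ((n t i : ℝ) / N t) (hn t i).1 ((hmean i).symm ▸ (hn t i).2)
  have hθ : ∀ t i, θ t i ∈ params (b i) := fun t i => (hu t i).1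
  have hscheme := fun t => (hη t).change_params hb hb0 (hθ t) (hϑ t)
  have hprob : ∀ t i, IsProbabilityMeasure (law (b i) (θ t i)) := fun t i =>
    isProbabilityMeasure_law (hb i) (hb0 i) (hθ t i)
  set p : ℕ → ℝ := fun t => boxProb b (θ t) s with hp
  have hpp : ∀ t, ∏ i, (law (b i) (θ t i)).real {s i} = p t := fun t =>
    Finset.prod_congr rfl fun i _ => law_real_singleton (hb i) (hb0 i) (hθ t i) (s i)
  set p₀ := ∏ i, δ i with hp₀
  have hp₀0 : 0 < p₀ := Finset.prod_pos fun i _ => hδ i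
  -- At least one colour is needed to have `p < 1`: its factor is at most `1 - δ`, and the other
  -- factors are at most `1`.
  set i₀ : Fin K := ⟨0, hK⟩
  have hpl : ∀ t, p₀ ≤ p t := fun t =>
    Finset.prod_le_prod (fun i _ => (hδ i).le) fun i _ => (hu t i).2.1
  have hpu : ∀ t, p t ≤ 1 - δ i₀ := fun t => by
    have hw : ∀ i, 0 ≤ weight (b i) (θ t i) (s i) := fun i => weight_nonneg (hb i) (hb0 i) (hθ t i) _
    refine le_trans ?_ (hu t i₀).2.2.1
    change ∏ i, weight (b i) (θ t i) (s i) ≤ _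
    rw [← Finset.mul_prod_erase _ _ (Finset.mem_univ i₀)]
    refine mul_le_of_le_one_right (hw i₀) (Finset.prod_le_one (fun i _ => hw i) fun i _ => ?_)
    exact (hu t i).2.2.1.trans (by linarith [hδ i])
  set v₀ := p₀ * δ i₀ with hv₀
  have hv₀0 : 0 < v₀ := mul_pos hp₀0 (hδ i₀)
  -- A lower bound for the variance uniform in `t`. It keeps `σ` away from `0` and lets a single
  -- threshold in `N` serve for all `t`.
  have hv : ∀ t, v₀ ≤ p t * (1 - p t) := fun t =>
    mul_le_mul (hpl t) (by linarith [hpu t]) (hδ i₀).le (hp₀0.le.trans (hpl t))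
  have hNtop : Tendsto (fun t => (N t : ℝ)) atTop atTop :=
    tendsto_natCast_atTop_atTop.comp hN.tendsto_atTop
  have htail : ∀ᶠ t in atTop, P.real {ω | 2 * √(1 + (K : ℝ) / 2) *
      (√(N t * Real.log (N t)) * boxSigma b (θ t) s) ≤ |boxCount (η t) s ω - N t * p t|} ≤
      2 * (∏ i, (c i)⁻¹) * (N t : ℝ) ^ (-(3 / 2) : ℝ) := by
    have hN₀ : ∀ᶠ t in atTop, ∀ i, N₀ i ≤ N t :=
      eventually_all.2 fun i => hN.tendsto_atTop.eventually_ge_atTop (N₀ i)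
    filter_upwards [hN₀,
      hNtop.eventually (eventually_mul_log_le (4 * (1 + (K : ℝ) / 2)) hv₀0)] with t h1 h2
    have hNt : (0 : ℝ) < N t := by exact_mod_cast hNpos t
    refine (hscheme t).measureReal_le_rpow (hNpos t) hc (fun i => ?_) s (hpp t)
      (hv₀0.trans_le (hv t)) (h2.trans (mul_le_mul_of_nonneg_right (hv t) hNt.le))
    exact (hu t i).2.2.2 (N t) (n t i) (h1 i) (mul_div_cancel₀ _ hNt.ne')
  have hXa : ∀ t ω, |boxCount (η t) s ω - N t * p t| ≤ N t := fun t ω => by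
    obtain ⟨h1, h2⟩ := boxCount_bounds (η t) s ω
    have h3 : (0 : ℝ) ≤ N t := Nat.cast_nonneg _
    have h4 : 0 ≤ p t := hp₀0.le.trans (hpl t)
    have h5 : p t ≤ 1 := (hpu t).trans (by linarith [hδ i₀])
    rw [abs_le]
    constructor <;> nlinarith [mul_nonneg h3 h4, mul_le_mul_of_nonneg_left h5 h3]
  have hC : 0 ≤ 2 * ∏ i, (c i)⁻¹ :=
    mul_nonneg (by norm_num) (Finset.prod_nonneg fun i _ => (inv_pos.2 (hc i)).le)
  have hfinal := ae_limsup_le_of_tail (P := P) (X := fun t => boxCount (η t) s)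
    (fun t => measurable_boxCount (hη t).measurable s) hN hXa (σ := fun t => boxSigma b (θ t) s)
    (Real.sqrt_pos.2 hv₀0) (fun t => Real.sqrt_le_sqrt (hv t))
    (show 0 ≤ 2 * √(1 + (K : ℝ) / 2) by positivity) hC htail
  have h4 : 2 * (2 * √(1 + (K : ℝ) / 2)) = 4 * √(1 + (K : ℝ) / 2) := by ring
  rwa [h4] at hfinal
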